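/- Write $\{0,1\}^*$ for the finite strings and $\{0,1\}^\omega$ for the infinite sequences over $\{0,1\}$, $S\upharpoonright n$ for the prefix of length $n$ of $S$, and $x^{-1}$ for the reverse of a string $x$. **Transducers and complexity.** A finite-state transducer (FST) is $(Q,q_0,\delta,\nu)$ with a finite state set $Q$, $q_0\in Q$, $\delta:Q\times\{0,1\}\to Q$ and $\nu:Q\times\{0,1\}\to\{0,1\}^*$; its output $T(x)$ on $x$ is the concatenation of the strings output while reading $x$ from left to right. A pebble transducer (PB) is a deterministic two-way transducer $(Q,q_0,F,p,\delta,\nu)$ on the tape $\dashv x\vdash$ with $p$ pebbles, $\delta:(Q\setminus F)\times\{0,1,\dashv,\vdash\}\times\{0,1\}^p\to Q\times\{+1,-1,\mathrm{push},\mathrm{pop}\}$ and $\nu:(Q\setminus F)\times\{0,1,\dashv,\vdash\}\times\{0,1\}^p\to\{0,1\}^*$; it sees the symbol under its head and which pebbles lie on that square, and it moves one square right or left, places the next pebble on the current square, or lifts the most recently placed pebble provided that it is on the current square (an impossible action leaves the successor undefined). $T(x)=w$ if $T$, started in state $q_0$ on the left end marker with no pebbles on the tape, reaches a state of $F$ after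 finitely many steps having output $w$. A binary representation of a class $\mathrm F$ of transducers is a computable surjection $\sigma$ from an infinite computable set of strings onto $\mathrm F$; the size $|T|_\sigma$ is the least length of a description of $T$. Put $D^k_{\mathrm F}(x)=\min\{|y| : |T|_\sigma\le k,\ T(y)=x \text{ for some } T\in \mathrm F\}$, and $D^k_{\mathrm F}(x)=\infty$ if there is no such $y$. A sequence $S$ is PB-deep if $$(\exists\alpha>0)(\forall k)(\exists k')(\forall^\infty n)\quad D^k_{\mathrm{FS}}(S\upharpoonright n)-D^{k'}_{\mathrm{PB}}(S\upharpoonright n)\ge\alpha n ,$$ where $\infty-\infty=-\infty$. $S$ is normal if every string $x$ occurs in $S$ with asymptotic frequency $2^{-|x|}$. **A family of sequences.** Let $k>2$ and $v\ge1$ be integers. Let $T_n$ be the set of strings of length $n$ that do not contain the substring $1^k$, and $A_n$ the set of palindromes in $T_n$. For $n\ge k$ list $A_n$ without repetition as $a_{n,1},\dots,a_{n,u_n}$ and split $T_n\setminus A_n$ into the disjoint sets $X_{n,1},Y_{n,1},\dots,X_{n,v+1},Y_{n,v+1}$, where $X_{n,i}$ is listed without repetition as $x_{n,i,1},\dots,x_{n,i,t_{n,i}}$,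 $Y_{n,i}$ consists of the strings $y_{n,i,j}=(x_{n,i,j})^{-1}$, and $t_{n,i}=\lfloor |T_n\setminus A_n|/(2v)\rfloor$ for $i\le v$, such that every $X_{n,i}$ is non-empty, $x_{n,i,1}$ starts with $0$ and $x_{n,i,t_{n,i}}$ ends with $0$, except that $X_{n,v+1}$ may be empty. Let $f(k)=2k$ and $f(n+1)=f(n)+v+2$. For $1\le n<k$ let $S_n$ be the concatenation of all strings of length $n$ in lexicographic order, and for $n\ge k$ let $$S_n=a_{n,1}\cdots a_{n,u_n}\,1^{f(n)}\,z_{n,1}\cdots z_{n,v+1},\qquad z_{n,i}=x_{n,i,1}\cdots x_{n,i,t_{n,i}}\,1^{f(n)+i}\,y_{n,i,t_{n,i}}\cdots y_{n,i,1}.$$ Let $S=S_1\cdots S_{k-1}\,1^k1^{k+1}\cdots1^{2k-1}\,S_kS_{k+1}\cdots$. **Statement.** There exists a non-normal PB-deep sequence. More precisely, there are $k>2$, $v\ge1$ and a sequence $S$ obtained by the above construction (for some choice of the listings) such that the string $01^{2k}0$ occurs at only finitely many positions of $S$, $S$ is not normal, and $S$ is PB-deep with respect to all binary representations of the FSTs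 and of the pebble transducers. -/

import Mathlib

/-!  Strings over `{0,1}` are `List Bool` (`false` is `0`, `true` is `1`) and infinite sequences are
functions `ℕ → Bool`.  -/

namespace PebbleDepth

/-- The string `S[i] S[i+1] ⋯ S[i+len-1]`. -/
def substring (S : ℕ → Bool) (i len : ℕ) : List Bool :=
  (List.range len).map fun j => S (i + j)

/-- The prefix `S ↾ n`. -/
def take (S : ℕ → Bool) (n : ℕ) : List Bool :=
  substring S 0 n

/-- The number of positions `i < n` at which `x` occurs as a substring of `S`. -/
def occurrences (S : ℕ → Bool) (x : List Bool) (n : ℕ) : ℕ :=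
  ((Finset.range n).filter fun i => substring S i x.length = x).card

/-- Borel normality (in base two): every string `x` occurs in `S` with asymptotic
frequency `2 ^ (-|x|)`. -/
def IsNormal (S : ℕ → Bool) : Prop :=
  ∀ x : List Bool,
    Filter.Tendsto (fun n : ℕ => (occurrences S x n : ℝ) / n) Filter.atTop
      (nhds ((1 / 2 : ℝ) ^ x.length))

/-! ### Finite-state transducers -/

/-- Finite-state transducers; the non-empty finite state set is `{0, …, numStates - 1}`. -/
structure FST where
  numStates : ℕ
  start : Fin numStates
  next : Fin numStates → Bool → Fin numStates
  out : Fin numStates → Bool → List Bool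

namespace FST

/-- The state reached from `q` after reading a string. -/
def stateFrom (T : FST) : Fin T.numStates → List Bool → Fin T.numStates
  | q, [] => q
  | q, b :: x => T.stateFrom (T.next q b) x

/-- The string written while reading a string from state `q`. -/
def outputFrom (T : FST) : Fin T.numStates → List Bool → List Bool
  | _, [] => []
  | q, b :: x => T.out q b ++ T.outputFrom (T.next q b) x

/-- The output `T(x)`. -/
def output (T : FST) (x : List Bool) : List Bool :=
  T.outputFrom T.start x

theorem output_nil (T : FST) : T.output [] = [] := rfl

theorem output_append_singleton (T : FST) (x : List Bool) (b : Bool) :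
    T.output (x ++ [b]) = T.output x ++ T.out (T.stateFrom T.start x) b := by
  have h : ∀ (x : List Bool) (q : Fin T.numStates),
      T.outputFrom q (x ++ [b]) = T.outputFrom q x ++ T.out (T.stateFrom q x) b := by
    intro x
    induction x with
    | nil => intro q; simp [outputFrom, stateFrom]
    | cons a x ih => intro q; simp [outputFrom, stateFrom, ih]
  exact h x T.start

/-- The complete finite description of `T`: number of states, start state, and the table of the
transition and output functions. -/
def table (T : FST) : ℕ × ℕ × List (ℕ × List Bool) :=
  (T.numStates, (T.start : ℕ),
    (List.finRange T.numStates).flatMap fun q =>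
      [false, true].map fun b => ((T.next q b : ℕ), T.out q b))

end FST

/-! ### Pebble transducers -/

/-- Symbols on the tape `⊣ x ⊢`: the left end marker `⊣`, the right end marker `⊢`, and bits. -/
inductive TapeSymbol where
  | leftEnd
  | rightEnd
  | bit (b : Bool)

/-- The actions `+1`, `-1`, `push`, `pop`. -/
inductive Action where
  | right
  | left
  | push
  | pop

/-- A number for each action, used to write transition tables. -/
def Action.code : Action → ℕ
  | .right => 0
  | .left => 1
  | .push => 2
  | .pop => 3

/-- Deterministic pebble transducers `(Q, q₀, F, k, δ, ν)` with `Q = {0, …, numStates - 1}` and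
`k = numPebbles`; the transition function `δ` (here `next`) and the output function `ν` (here `out`)
have domain `(Q - F) × ({0,1} ∪ {⊣,⊢}) × {0,1}^k`. -/
structure PebbleTransducer where
  numStates : ℕ
  start : Fin numStates
  final : Finset (Fin numStates)
  numPebbles : ℕ
  next : {q : Fin numStates // q ∉ final} → TapeSymbol → (Fin numPebbles → Bool) →
    Fin numStates × Action
  out : {q : Fin numStates // q ∉ final} → TapeSymbol → (Fin numPebbles → Bool) → List Bool

/-- The symbol on square `i` of the tape `⊣ x ⊢`, whose squares are numbered `0, …, |x| + 1`. -/
def tapeSymbol (x : List Bool) : ℕ → TapeSymbol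
  | 0 => .leftEnd
  | i + 1 =>
    match x[i]? with
    | some b => .bit b
    | none => .rightEnd

namespace PebbleTransducer

/-- Configurations.  As pebbles are placed and lifted in a stack-like fashion, the placement of the
pebbles is given by the list of the positions of the pebbles `1, …, l` currently on the tape,
in this order. -/
structure Config (T : PebbleTransducer) where
  state : Fin T.numStates
  head : ℕ
  pebbles : List ℕ
  output : List Bool

/-- The initial configuration. -/
def init (T : PebbleTransducer) : T.Config :=
  ⟨T.start, 0, [], []⟩

/-- Which pebbles are on the square under the head. -/
def Config.seen {T : PebbleTransducer} (c : T.Config) : Fin T.numPebbles → Bool :=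
  fun j => decide (c.pebbles[(j : ℕ)]? = some c.head)

/-- The effect of an action on the head position and the pebbles, when the head is at `i`;
`none` if the action is impossible. -/
def act (T : PebbleTransducer) (x : List Bool) (i : ℕ) (pebbles : List ℕ) :
    Action → Option (ℕ × List ℕ)
  | .right => if i = x.length + 1 then none else some (i + 1, pebbles)
  | .left => if i = 0 then none else some (i - 1, pebbles)
  | .push => if pebbles.length < T.numPebbles then some (i, pebbles ++ [i]) else none
  | .pop => if pebbles.getLast? = some i then some (i, pebbles.dropLast) else none

/-- The successor configuration on input `x`, if there is one. -/
def step (T : PebbleTransducer) (x : List Bool) (c : T.Config) : Option T.Config :=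
  if hq : c.state ∈ T.final then none
  else
    let a := tapeSymbol x c.head
    let r := T.next ⟨c.state, hq⟩ a c.seen
    (T.act x c.head c.pebbles r.2).map fun p =>
      ⟨r.1, p.1, p.2, c.output ++ T.out ⟨c.state, hq⟩ a c.seen⟩

/-- `T.Outputs x w` means `T(x) = w`: a finite run on input `x` from the initial configuration
reaches a final state with output `w`. -/
def Outputs (T : PebbleTransducer) (x w : List Bool) : Prop :=
  ∃ c : T.Config, Relation.ReflTransGen (fun c c' : T.Config => T.step x c = some c') T.init c ∧
    c.state ∈ T.final ∧ c.output = w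

/-- The complete finite description of `T`: numbers of states and pebbles, start state, final
states, and the table of the transition and output functions (the pebble vectors `{0,1}^k` are
listed through the binary expansions of the numbers below `2 ^ k`). -/
def table (T : PebbleTransducer) :
    (ℕ × ℕ) × ℕ × List ℕ × List (ℕ × ℕ × List Bool) :=
  ((T.numStates, T.numPebbles), (T.start : ℕ),
    ((List.finRange T.numStates).filter fun q => q ∈ T.final).map (fun q => (q : ℕ)),
    (List.finRange T.numStates).flatMap fun q =>
      if hq : q ∈ T.final then []
      else
        [TapeSymbol.leftEnd, .rightEnd, .bit false, .bit true].flatMap fun a =>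
          (List.range (2 ^ T.numPebbles)).map fun m =>
            let b : Fin T.numPebbles → Bool := fun j => m.testBit j
            (((T.next ⟨q, hq⟩ a b).1 : ℕ), (T.next ⟨q, hq⟩ a b).2.code, T.out ⟨q, hq⟩ a b))

end PebbleTransducer

/-! ### Binary representations and `k`-string complexity -/

/-- A binary representation of a class `F` of transducers: a surjective computable map `σ : D → F`
from an infinite computable set `D` of strings.  Computability means that the complete finite
description `table (σ d)` of `σ d` can be computed from `d`. -/
structure BinaryRepresentation {F C : Type} [Primcodable C] (table : F → C) where
  D : Set (List Bool)
  infinite_D : D.Infinite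
  computable_D : ComputablePred fun x => x ∈ D
  σ : D → F
  surjective : Function.Surjective σ
  computable : ∃ g : List Bool → C, Computable g ∧ ∀ d : D, g d = table (σ d)

/-- The size `|T|_σ`: the least length of a description of `T`. -/
noncomputable def BinaryRepresentation.size {F C : Type} [Primcodable C] {table : F → C}
    (R : BinaryRepresentation table) (T : F) : ℕ :=
  sInf {n | ∃ d : R.D, R.σ d = T ∧ (d : List Bool).length = n}

/-- The `k`-F complexity of `x`: the least length of a string `y` with `T(y) = x` for some
transducer `T` of size at most `k`, and `∞` if there is none.  Here `Out T y x` is the relation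
`T(y) = x`. -/
noncomputable def BinaryRepresentation.complexity {F C : Type} [Primcodable C] {table : F → C}
    (R : BinaryRepresentation table) (Out : F → List Bool → List Bool → Prop)
    (k : ℕ) (x : List Bool) : ℕ∞ :=
  sInf {m : ℕ∞ | ∃ (T : F) (y : List Bool), R.size T ≤ k ∧ Out T y x ∧ m = (y.length : ℕ∞)}

/-- The `k`-FS complexity of a string. -/
noncomputable def fsComplexity (R : BinaryRepresentation FST.table) (k : ℕ) (x : List Bool) : ℕ∞ :=
  R.complexity (fun T y x => T.output y = x) k x

/-- The `k`-PB complexity of a string. -/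
noncomputable def pbComplexity (R : BinaryRepresentation PebbleTransducer.table) (k : ℕ)
    (x : List Bool) : ℕ∞ :=
  R.complexity PebbleTransducer.Outputs k x

/-- PB-deep sequences.  The difference is taken in the extended reals, where `∞ - ∞ = -∞`. -/
def PBDeep (RFS : BinaryRepresentation FST.table)
    (RPB : BinaryRepresentation PebbleTransducer.table) (S : ℕ → Bool) : Prop :=
  ∃ α : ℝ, 0 < α ∧ ∀ k : ℕ, ∃ k' : ℕ, ∀ᶠ n : ℕ in Filter.atTop,
    (((fsComplexity RFS k (take S n) : ENNReal) : EReal) -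
      ((pbComplexity RPB k' (take S n) : ENNReal) : EReal)) ≥ ((α * n : ℝ) : EReal)

/-! ### The sequence built from strings without long runs of ones -/

/-- The set `T_n` of the strings of length `n` without the substring `1^k` (equivalently, without
`1^j` for all `j ≥ k`). -/
def avoiding (k n : ℕ) : Set (List Bool) :=
  {w | w.length = n ∧ ¬ List.replicate k true <:+: w}

/-- The set `A_n` of the palindromes in `T_n`. -/
def palindromes (k n : ℕ) : Set (List Bool) :=
  {w ∈ avoiding k n | w.reverse = w}

/-- The choices made in the construction with parameters `k` and `v`: for all `n ≥ k`, a listing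
`pal n` of `A_n`, and listings `X n i` of sets `X_{n,1}, …, X_{n,v+1}` which together with the sets
`Y_{n,i}` of the reversed strings split `T_n - A_n`. -/
structure BlockListing (k v : ℕ) where
  pal : ℕ → List (List Bool)
  X : ℕ → ℕ → List (List Bool)
  nodup_pal : ∀ n, k ≤ n → (pal n).Nodup
  mem_pal : ∀ n, k ≤ n → ∀ w, w ∈ pal n ↔ w ∈ palindromes k n
  /-- No string is listed twice in `X_{n,1}, …, X_{n,v+1}, Y_{n,1}, …, Y_{n,v+1}`. -/
  nodup_X : ∀ n, k ≤ n →
    (((List.range (v + 1)).flatMap fun i => X n (i + 1)) ++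
      ((List.range (v + 1)).flatMap fun i => (X n (i + 1)).map List.reverse)).Nodup
  /-- The strings listed in the sets `X_{n,i}` and `Y_{n,i}` are those of `T_n - A_n`. -/
  mem_X : ∀ n, k ≤ n → ∀ w,
    (∃ i, 1 ≤ i ∧ i ≤ v + 1 ∧ (w ∈ X n i ∨ w.reverse ∈ X n i)) ↔ w ∈ avoiding k n \ palindromes k n
  /-- `X_{n,1}, …, X_{n,v}` have `⌊|T_n - A_n| / (2v)⌋` elements each; the remaining strings are in
  `X_{n,v+1}` and `Y_{n,v+1}`. -/
  length_X : ∀ n, k ≤ n → ∀ i, 1 ≤ i → i ≤ v →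
    (X n i).length = (avoiding k n \ palindromes k n).ncard / (2 * v)
  /-- The first string of `X_{n,i}` starts with `0` and its last string ends with `0`, except that
  `X_{n,v+1}` may be empty. -/
  ends_X : ∀ n, k ≤ n → ∀ i, 1 ≤ i → i ≤ v + 1 →
    (i = v + 1 ∧ X n i = []) ∨
      ((X n i).head?.bind List.head? = some false ∧
        (X n i).getLast?.bind List.getLast? = some false)

/-- All strings of length `n`, in lexicographic order. -/
def allStrings : ℕ → List (List Bool)
  | 0 => [[]]
  | n + 1 => (allStrings n).map (false :: ·) ++ (allStrings n).map (true :: ·)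

/-- The string `1^m`. -/
def ones (m : ℕ) : List Bool :=
  List.replicate m true

/-- `f(n)` for `n ≥ k`, that is `f(k) = 2k` and `f(n+1) = f(n) + v + 2`. -/
def flagLength (k v n : ℕ) : ℕ :=
  2 * k + (n - k) * (v + 2)

/-- `S_1 S_2 ⋯ S_{k-1} 1^k 1^{k+1} ⋯ 1^{2k-1}`, where `S_n` is the concatenation of all strings of
length `n` for `n < k`. -/
def initialPart (k : ℕ) : List Bool :=
  ((List.range (k - 1)).flatMap fun j => (allStrings (j + 1)).flatten) ++
    (List.range k).flatMap fun j => ones (k + j)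

namespace BlockListing

variable {k v : ℕ} (L : BlockListing k v)

/-- The listing of `Y_{n,i}`: the strings of `X_{n,i}` reversed, and in reversed order. -/
def Y (n i : ℕ) : List (List Bool) :=
  ((L.X n i).map List.reverse).reverse

/-- `z_{n,i} = x_{n,i,1} ⋯ x_{n,i,t} 1^{f(n)+i} y_{n,i,t} ⋯ y_{n,i,1}`. -/
def zone (n i : ℕ) : List Bool :=
  (L.X n i).flatten ++ ones (flagLength k v n + i) ++ (L.Y n i).flatten

/-- `S_n = a_1 ⋯ a_u 1^{f(n)} z_{n,1} ⋯ z_{n,v+1}`, for `n ≥ k`. -/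
def stage (n : ℕ) : List Bool :=
  (L.pal n).flatten ++ ones (flagLength k v n) ++
    (List.range (v + 1)).flatMap fun i => L.zone n (i + 1)

/-- The finite string `S_1 ⋯ S_{k-1} 1^k ⋯ 1^{2k-1} S_k S_{k+1} ⋯ S_{k+m-1}`. -/
def upTo (m : ℕ) : List Bool :=
  initialPart k ++ (List.range m).flatMap fun j => L.stage (k + j)

/-- `S` is the infinite concatenation `S_1 ⋯ S_{k-1} 1^k 1^{k+1} ⋯ 1^{2k-1} S_k S_{k+1} ⋯`. -/
def IsSequence (S : ℕ → Bool) : Prop :=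
  ∀ m, take S (L.upTo m).length = L.upTo m

end BlockListing

end PebbleDepth

namespace PebbleDepth

/-! The parameters are `k = 100` and `v = 1`, with `X_{n,2}` empty. Up to the palindromes and three
flags of length linear in `n`, stage `n` is then `u 1^m u⁻¹`, where `u` lists one string of each
pair of distinct reverses in `T_n`.

Finite-state lower bound. Every string of `T_n` occurs exactly once as a block of stage `n`, and
`|T_n| ≥ 2^(99⌊n/100⌋)`. A fixed transducer has bounded output per step, so a string written while
fewer than `19n/20` symbols are read is determined by a bounded overhang, a state and that short
input. There are only `O(2^(19n/20))` such strings. Almost all of the sequence therefore costs at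
least `19/20` input symbols per output symbol, and after absorbing the error an input for the prefix
of length `n` has length at least `9n/10` (`exists_fst_bound`, `eventually_fst`).

Pebble upper bound. A two-way transducer without pebbles reads `u` from blocks of 101 symbols
carrying 100 each, then runs back over the same blocks to write `u⁻¹` (`exists_decodes_mirror`). A
complete stage thus costs about `101/200` per symbol. The unfinished last stage is copied at cost
`101/100`, but a stage is at most about `2.2` times what precedes it, so the total is at most `7n/8`
(`exists_pb_bound`, `eventually_pb`).

The gap is `9/10 - 7/8 = 1/40`. Only finitely many transducers have size at most `k`, so the bound
for each single FST suffices (`pbDeep_of_eventually`). Non-normality holds because every flag after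
stage `k` is longer than `2k` and other pieces contain no `1^k`, so `01^{2k}0` cannot recur forever
(`finite_occurrences`). -/

theorem mem_allStrings {n : ℕ} {w : List Bool} : w ∈ allStrings n ↔ w.length = n := by
  induction n generalizing w with
  | zero => simp [allStrings]
  | succ n ih =>
    cases w with
    | nil => simp [allStrings]
    | cons c w => cases c <;> simp [allStrings, ih]

theorem length_allStrings (n : ℕ) : (allStrings n).length = 2 ^ n := by
  induction n with
  | zero => rfl
  | succ n ih => simp [allStrings, ih, pow_succ]; ring

/-- The strings of length at most `r`. -/
def stringsUpTo (r : ℕ) : Finset (List Bool) :=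
  (Finset.range (r + 1)).biUnion fun i => (allStrings i).toFinset

theorem mem_stringsUpTo {r : ℕ} {w : List Bool} : w ∈ stringsUpTo r ↔ w.length ≤ r := by
  simp [stringsUpTo, mem_allStrings]

theorem card_stringsUpTo_le (r : ℕ) : (stringsUpTo r).card ≤ 2 ^ (r + 1) := by
  refine Finset.card_biUnion_le.trans ?_
  calc ∑ i ∈ Finset.range (r + 1), (allStrings i).toFinset.card
      ≤ ∑ i ∈ Finset.range (r + 1), 2 ^ i :=
        Finset.sum_le_sum fun i _ => (List.toFinset_card_le _).trans (length_allStrings i).le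
    _ ≤ 2 ^ (r + 1) := by
        rw [Nat.geomSum_eq le_rfl]
        simp

/-! ### Incompressibility of most strings for a fixed finite-state transducer. -/

namespace FST

/-- Up to a prefix of at most `L` symbols that is already written, the transducer writes `x` while
reading `v`. -/
def Produces (T : FST) (L : ℕ) (v x : List Bool) : Prop :=
  ∃ (e : List Bool) (q : Fin T.numStates), e.length ≤ L ∧ x <+: e ++ T.outputFrom q v

theorem exists_length_out_le (T : FST) : ∃ L, ∀ q b, (T.out q b).length ≤ L :=
  ⟨Finset.univ.sup fun p : Fin T.numStates × Bool => (T.out p.1 p.2).length, fun q b =>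
    Finset.le_sup (f := fun p : Fin T.numStates × Bool => (T.out p.1 p.2).length)
      (Finset.mem_univ (q, b))⟩

/-- The input is cut at the first point where `x` has been written completely. The last symbol read
may write beyond the end of `x`; this overhang `e'` has length at most `L` and becomes the already
written prefix for what follows. -/
theorem exists_split {T : FST} {L : ℕ} (hL : ∀ q b, (T.out q b).length ≤ L) (x : List Bool) :
    ∀ (y : List Bool) (q : Fin T.numStates) (e w : List Bool), e.length ≤ L + x.length →
      e ++ T.outputFrom q y = x ++ w →
      ∃ v y' e' q', y = v ++ y' ∧ x <+: e ++ T.outputFrom q v ∧ e'.length ≤ L ∧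
        e' ++ T.outputFrom q' y' = w := by
  intro y
  induction y with
  | nil =>
    intro q e w he h
    simp only [outputFrom, List.append_nil] at h
    subst h
    exact ⟨[], [], w, q, rfl, by simp [outputFrom], by simp at he; omega, by simp [outputFrom]⟩
  | cons b y ih =>
    intro q e w he h
    by_cases hx : x.length ≤ e.length
    · have hxe : x <+: e :=
        List.prefix_of_prefix_length_le (h ▸ List.prefix_append x w) (List.prefix_append e _) hx
      obtain ⟨e', rfl⟩ := hxe
      refine ⟨[], b :: y, e', q, rfl, by simp [outputFrom], by simp at he; omega, ?_⟩
      simpa using h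
    · have h1 := hL q b
      obtain ⟨v, y', e', q', rfl, h2, h3, h4⟩ := ih (T.next q b) (e ++ T.out q b) w
        (by simp; omega) (by simpa [outputFrom] using h)
      exact ⟨b :: v, y', e', q', rfl, by simpa [outputFrom] using h2, h3, h4⟩

/-- A cost that bounds from below the input needed for each single string adds up over a
concatenation, since consecutive strings use disjoint parts of the input. -/
theorem sum_le_of_output {T : FST} {L : ℕ} (hL : ∀ q b, (T.out q b).length ≤ L)
    {c : List Bool → ℕ} {r : ℕ} (hc : ∀ v x, T.Produces L v x → c x ≤ r * v.length)
    (xs : List (List Bool)) :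
    ∀ (y : List Bool) (q : Fin T.numStates) (e w : List Bool), e.length ≤ L →
      e ++ T.outputFrom q y = xs.flatten ++ w → (xs.map c).sum ≤ r * y.length := by
  induction xs with
  | nil => simp
  | cons x xs ih =>
    intro y q e w he h
    obtain ⟨v, y', e', q', rfl, h2, h3, h4⟩ := exists_split hL x y q e (xs.flatten ++ w)
      (by omega) (by simpa using h)
    have h5 := ih y' q' e' w h3 h4
    have h6 := hc v x ⟨e, q, he, h2⟩
    simp only [List.map_cons, List.sum_cons, List.length_append, mul_add]
    omega

/-- The string `x` is produced while reading less than `19 / 20` of its length. -/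
def Short (T : FST) (L : ℕ) (x : List Bool) : Prop :=
  ∃ v, 20 * v.length < 19 * x.length ∧ T.Produces L v x

open Classical in
/-- The number of symbols wasted on `x`: those of a string that can be produced too cheaply. -/
noncomputable def deficit (T : FST) (L : ℕ) (x : List Bool) : ℕ :=
  if T.Short L x then x.length else 0

theorem length_le_of_output {T : FST} {L : ℕ} (hL : ∀ q b, (T.out q b).length ≤ L)
    {xs : List (List Bool)} {y w : List Bool} (h : T.output y = xs.flatten ++ w) :
    19 * xs.flatten.length ≤ 20 * y.length + 19 * (xs.map (T.deficit L)).sum := by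
  classical
  -- Short strings are charged nothing here; their full length is returned as `deficit`.
  have h1 := sum_le_of_output (c := fun x => if T.Short L x then 0 else 19 * x.length) (r := 20) hL
    (by
      intro v x hv
      split_ifs with hs
      · exact Nat.zero_le _
      · by_contra hlt
        exact hs ⟨v, by omega, hv⟩) xs y T.start [] w (by simp) (by simpa [output] using h)
  refine le_trans ?_ (Nat.add_le_add_right h1 _)
  clear h1 h
  induction xs with
  | nil => simp
  | cons x xs ih =>
    simp only [List.flatten_cons, List.length_append, List.map_cons, List.sum_cons, deficit] at ih ⊢
    split_ifs <;> omega

/-- A short string of length `m` is recovered from the triple of overhang, state and input, so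
distinctness of the listed strings reduces the bound to counting triples. -/
theorem sum_deficit_le (T : FST) (L m : ℕ) {l : List (List Bool)} (hl : l.Nodup)
    (hm : ∀ x ∈ l, x.length = m) :
    (l.map (T.deficit L)).sum ≤ m * (2 ^ (L + 1) * T.numStates * 2 ^ (19 * m / 20 + 1)) := by
  classical
  have h1 : (l.map (T.deficit L)).sum = m * (l.filter fun x => T.Short L x).length := by
    clear hl
    induction l with
    | nil => simp
    | cons x l ih =>
      have h2 := hm x (by simp)
      have h3 := ih fun z hz => hm z (by simp [hz])
      by_cases hs : T.Short L x
      · simp [deficit, hs, h3, h2]; ring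
      · simp [deficit, hs, h3]
  rw [h1]
  refine Nat.mul_le_mul_left m ?_
  rw [← List.toFinset_card_of_nodup (hl.filter _)]
  have h2 : (l.filter fun x => T.Short L x).toFinset ⊆
      (stringsUpTo L ×ˢ (Finset.univ : Finset (Fin T.numStates)) ×ˢ stringsUpTo (19 * m / 20)).image
        fun p => (p.1 ++ T.outputFrom p.2.1 p.2.2).take m := by
    intro x hx
    simp only [List.mem_toFinset, List.mem_filter, decide_eq_true_eq] at hx
    obtain ⟨hxl, v, hv, e, q, he, hp⟩ := hx
    have hxm := hm x hxl
    refine Finset.mem_image.2 ⟨(e, q, v), ?_, ?_⟩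
    · simp only [Finset.mem_product, mem_stringsUpTo, Finset.mem_univ, true_and]
      exact ⟨he, by omega⟩
    · rw [← hxm]
      exact (List.prefix_iff_eq_take.1 hp).symm
  refine (Finset.card_le_card h2).trans (Finset.card_image_le.trans ?_)
  rw [Finset.card_product, Finset.card_product, Finset.card_univ, Fintype.card_fin, ← mul_assoc]
  exact Nat.mul_le_mul (Nat.mul_le_mul_right _ (card_stringsUpTo_le L)) (card_stringsUpTo_le _)

end FST
end PebbleDepth

namespace PebbleDepth

/-! ### A two-way transducer that copies and reverses -/

namespace PebbleTransducer

/-- A two-way transducer without pebbles; `δ s a` is the next state, whether the head moves to the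
right, and the output. -/
noncomputable def ofTwoWay {σ : Type} [Fintype σ] (start : σ) (fin : σ → Prop)
    (δ : σ → TapeSymbol → σ × Bool × List Bool) : PebbleTransducer where
  numStates := Fintype.card σ
  start := Fintype.equivFin σ start
  final := by
    classical exact Finset.univ.filter fun q => fin ((Fintype.equivFin σ).symm q)
  numPebbles := 0
  next := fun q a _ =>
    (Fintype.equivFin σ (δ ((Fintype.equivFin σ).symm q) a).1,
      if (δ ((Fintype.equivFin σ).symm q) a).2.1 then .right else .left)
  out := fun q a _ => (δ ((Fintype.equivFin σ).symm q) a).2.2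

section TwoWay

variable {σ : Type} [Fintype σ] {start : σ} {fin : σ → Prop}
  {δ : σ → TapeSymbol → σ × Bool × List Bool}

/-- The configuration of `ofTwoWay` in state `s` with the head on square `i`. -/
noncomputable def cfg (start : σ) (fin : σ → Prop) (δ : σ → TapeSymbol → σ × Bool × List Bool)
    (s : σ) (i : ℕ) (o : List Bool) : (ofTwoWay start fin δ).Config :=
  ⟨Fintype.equivFin σ s, i, [], o⟩

theorem mem_final {s : σ} :
    Fintype.equivFin σ s ∈ (ofTwoWay start fin δ).final ↔ fin s := by
  classical exact Finset.mem_filter.trans (by simp)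

theorem step_right {x o o' : List Bool} {s s' : σ} {i : ℕ} (hs : ¬ fin s)
    (h : δ s (tapeSymbol x i) = (s', true, o')) (hi : i ≠ x.length + 1) :
    (ofTwoWay start fin δ).step x (cfg start fin δ s i o) =
      some (cfg start fin δ s' (i + 1) (o ++ o')) := by
  have hq : (cfg start fin δ s i o).state ∉ (ofTwoWay start fin δ).final := fun h => hs (mem_final.1 h)
  rw [step, dif_neg hq]
  simp [cfg, ofTwoWay, act, h, hi]

theorem step_left {x o o' : List Bool} {s s' : σ} {i : ℕ} (hs : ¬ fin s)
    (h : δ s (tapeSymbol x i) = (s', false, o')) (hi : i ≠ 0) :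
    (ofTwoWay start fin δ).step x (cfg start fin δ s i o) =
      some (cfg start fin δ s' (i - 1) (o ++ o')) := by
  have hq : (cfg start fin δ s i o).state ∉ (ofTwoWay start fin δ).final := fun h => hs (mem_final.1 h)
  rw [step, dif_neg hq]
  simp [cfg, ofTwoWay, act, h, hi]

end TwoWay

end PebbleTransducer

theorem tapeSymbol_append (p : List Bool) (c : Bool) (q : List Bool) :
    tapeSymbol (p ++ c :: q) (p.length + 1) = .bit c := by
  simp [tapeSymbol]

theorem tapeSymbol_length_add_one (x : List Bool) : tapeSymbol x (x.length + 1) = .rightEnd := by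
  simp [tapeSymbol]

namespace Copier

/-- The modes of the transducer: it writes while it reads forward or backward, and skips forward
without writing. -/
inductive Mode where
  | fwd
  | turnLeft
  | bwd
  | turnRight
  | skip
  | halt
  deriving DecidableEq

instance : Fintype Mode :=
  ⟨{.fwd, .turnLeft, .bwd, .turnRight, .skip, .halt}, fun m => by cases m <;> decide⟩

/-- The input consists of blocks of length `b + 3`.  This one stands for the `b + 2` symbols `d`. -/
def raw (d : List Bool) : List Bool := false :: d

/-- The block standing for a single symbol, which is written in forward mode only. -/
def lit (b : ℕ) (c : Bool) : List Bool := true :: false :: c :: List.replicate b false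

/-- The block where going backward ends. -/
def beg (b : ℕ) : List Bool := true :: true :: true :: List.replicate b false

/-- The block where going backward starts. -/
def rev (b : ℕ) : List Bool := true :: true :: false :: List.replicate b false

/-- The output on a block in forward mode. -/
def emit : List Bool → List Bool
  | false :: d => d
  | true :: false :: c :: _ => [c]
  | _ => []

/-- The output on a block in backward mode. -/
def emitRev : List Bool → List Bool
  | false :: d => d.reverse
  | _ => []

/-- The next mode and the output after reading a block. -/
def endBlock (b : ℕ) : Mode → List Bool → Mode × List Bool
  | .fwd, w => if w = rev b then (.turnLeft, []) else (.fwd, emit w)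
  | .skip, w => if w = rev b then (.fwd, []) else (.skip, [])
  | .bwd, w => if w = beg b then (.turnRight, []) else (.bwd, emitRev w)
  | m, _ => (m, [])

/-- Incompletely read blocks. -/
abbrev Buffer (b : ℕ) : Type := {l : List Bool // l.length ≤ b + 3}

noncomputable instance (b : ℕ) : Fintype (Buffer b) :=
  Fintype.subtype (stringsUpTo (b + 3)) fun _ => mem_stringsUpTo

/-- A list as the content of the buffer. -/
def clamp (b : ℕ) (l : List Bool) : Buffer b := ⟨l.take (b + 3), by simp⟩

theorem clamp_val {b : ℕ} {l : List Bool} (h : l.length ≤ b + 3) : (clamp b l).1 = l :=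
  List.take_of_length_le h

/-- The transition function. -/
def δ (b : ℕ) : Mode × Buffer b → TapeSymbol → (Mode × Buffer b) × Bool × List Bool
  | (.fwd, buf), .bit c =>
    if buf.1.length + 1 < b + 3 then ((.fwd, clamp b (buf.1 ++ [c])), true, [])
    else (((endBlock b .fwd (buf.1 ++ [c])).1, clamp b []), true,
      (endBlock b .fwd (buf.1 ++ [c])).2)
  | (.skip, buf), .bit c =>
    if buf.1.length + 1 < b + 3 then ((.skip, clamp b (buf.1 ++ [c])), true, [])
    else (((endBlock b .skip (buf.1 ++ [c])).1, clamp b []), true,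
      (endBlock b .skip (buf.1 ++ [c])).2)
  | (.bwd, buf), .bit c =>
    if buf.1.length + 1 < b + 3 then ((.bwd, clamp b (c :: buf.1)), false, [])
    else (((endBlock b .bwd (c :: buf.1)).1, clamp b []), false,
      (endBlock b .bwd (c :: buf.1)).2)
  -- Completing a block leaves the head one square past it, so each turn spends one step moving back
  -- onto that block, which is then read again in the new direction.
  | (.turnLeft, _), _ => ((.bwd, clamp b []), false, [])
  | (.turnRight, _), _ => ((.skip, clamp b []), true, [])
  | (.fwd, _), .leftEnd => ((.fwd, clamp b []), true, [])
  | (.fwd, _), .rightEnd => ((.halt, clamp b []), false, [])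
  -- A filler value: no run on an input built below reaches these cases.
  | s, _ => (s, true, [])

/-- The transducer. -/
noncomputable def machine (b : ℕ) : PebbleTransducer :=
  PebbleTransducer.ofTwoWay (σ := Mode × Buffer b) (.fwd, clamp b []) (fun s => s.1 = .halt) (δ b)

/-- The configuration in mode `m` with buffer `l`, the head on square `i`, and output `o`. -/
noncomputable def conf (b : ℕ) (m : Mode) (l : List Bool) (i : ℕ) (o : List Bool) :
    (machine b).Config :=
  PebbleTransducer.cfg (σ := Mode × Buffer b) (.fwd, clamp b []) (fun s => s.1 = .halt) (δ b)
    (m, clamp b l) i o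

/-- Reachability on input `x`. -/
def Reach (b : ℕ) (x : List Bool) : (machine b).Config → (machine b).Config → Prop :=
  Relation.ReflTransGen fun c c' => (machine b).step x c = some c'

/-! ### Runs of the transducer over blocks. -/

theorem reach_right {b : ℕ} {x l l' o o' : List Bool} {m m' : Mode} {i : ℕ} (hm : m ≠ .halt)
    (h : δ b (m, clamp b l) (tapeSymbol x i) = ((m', clamp b l'), true, o'))
    (hi : i ≤ x.length) : Reach b x (conf b m l i o) (conf b m' l' (i + 1) (o ++ o')) :=
  .single (PebbleTransducer.step_right hm h (by omega))

theorem reach_left {b : ℕ} {x l l' o o' : List Bool} {m m' : Mode} {i : ℕ} (hm : m ≠ .halt)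
    (h : δ b (m, clamp b l) (tapeSymbol x (i + 1)) = ((m', clamp b l'), false, o')) :
    Reach b x (conf b m l (i + 1) o) (conf b m' l' i (o ++ o')) :=
  .single (PebbleTransducer.step_left hm h (by omega))

theorem reach_block_right {b : ℕ} {m : Mode} (hm : m = .fwd ∨ m = .skip) (pre post o : List Bool) :
    ∀ (r l : List Bool), r ≠ [] → (l ++ r).length = b + 3 →
      Reach b (pre ++ (l ++ r) ++ post) (conf b m l (pre.length + l.length + 1) o)
        (conf b (endBlock b m (l ++ r)).1 [] (pre.length + (b + 3) + 1)
          (o ++ (endBlock b m (l ++ r)).2)) := by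
  intro r
  induction r with
  | nil => simp
  | cons c r ih =>
    intro l _ hl
    have hmh : m ≠ .halt := by rcases hm with rfl | rfl <;> simp
    have hsym : tapeSymbol (pre ++ (l ++ c :: r) ++ post) (pre.length + l.length + 1) = .bit c := by
      have := tapeSymbol_append (pre ++ l) c (r ++ post)
      simpa using this
    simp only [List.length_append, List.length_cons] at hl
    have hcl := clamp_val (b := b) (l := l) (by omega)
    have hle : pre.length + l.length + 1 ≤ (pre ++ (l ++ c :: r) ++ post).length := by
      simp
    cases r with
    | nil =>
      have hl' : ¬ l.length + 1 < b + 3 := by simp at hl; omega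
      have hl2 : l.length + 1 = b + 3 := by simpa using hl
      have key := reach_right (b := b) (o := o) (l := l) (l' := [])
        (m' := (endBlock b m (l ++ [c])).1) (o' := (endBlock b m (l ++ [c])).2) hmh
        (by rw [hsym]; rcases hm with rfl | rfl <;> simp [δ, hcl, hl']) hle
      have e : pre.length + l.length + 1 = pre.length + (b + 3) := by omega
      rw [e] at key ⊢
      exact key
    | cons c' r =>
      have hl' : l.length + 1 < b + 3 := by simp at hl; omega
      have key := reach_right (b := b) (o := o) (l := l) (l' := l ++ [c])
        (m' := m) (o' := []) hmh
        (by rw [hsym]; rcases hm with rfl | rfl <;> simp [δ, hcl, hl']) hle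
      have h2 := ih (l ++ [c]) (by simp) (by simp at hl ⊢; omega)
      simp only [List.append_assoc, List.singleton_append, List.length_append,
        List.length_singleton, List.append_nil, ← add_assoc] at h2 key ⊢
      exact key.trans h2

/-- Going backward, symbols are prepended to the buffer, so a completed block appears in its
original order. The unread part `r` shrinks from the right, hence the reverse induction. -/
theorem reach_block_left {b : ℕ} (pre post o : List Bool) (r : List Bool) :
    ∀ (l : List Bool), r ≠ [] → (r ++ l).length = b + 3 →
      Reach b (pre ++ (r ++ l) ++ post) (conf b .bwd l (pre.length + r.length) o)
        (conf b (endBlock b .bwd (r ++ l)).1 [] pre.length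
          (o ++ (endBlock b .bwd (r ++ l)).2)) := by
  induction r using List.reverseRecOn with
  | nil => simp
  | append_singleton r c ih =>
    intro l _ hl
    have hsym : tapeSymbol (pre ++ ((r ++ [c]) ++ l) ++ post) (pre.length + r.length + 1) =
        .bit c := by
      have := tapeSymbol_append (pre ++ r) c (l ++ post)
      simpa using this
    simp only [List.length_append, List.length_singleton] at hl
    have hcl := clamp_val (b := b) (l := l) (by omega)
    rcases List.eq_nil_or_concat r with rfl | ⟨r', c', rfl⟩
    · have hl' : ¬ l.length + 1 < b + 3 := by simp at hl; omega
      have key := reach_left (b := b) (o := o) (l := l) (l' := []) (m := .bwd)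
        (m' := (endBlock b .bwd (c :: l)).1) (o' := (endBlock b .bwd (c :: l)).2) (by simp)
        (by rw [hsym]; simp [δ, hcl, hl'])
      simpa using key
    · have hl' : l.length + 1 < b + 3 := by simp at hl; omega
      have key := reach_left (b := b) (o := o) (l := l) (l' := c :: l) (m := .bwd)
        (m' := .bwd) (o' := []) (by simp) (by rw [hsym]; simp [δ, hcl, hl'])
      have h2 := ih (c :: l) (by simp) (by simp at hl ⊢; omega)
      simp only [List.append_assoc, List.length_append,
        List.length_singleton, List.append_nil, ← add_assoc, List.concat_eq_append,
        List.cons_append, List.nil_append] at h2 key ⊢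
      exact key.trans h2

theorem reach_blocks_fwd {b : ℕ} (ws : List (List Bool)) :
    ∀ (pre post o : List Bool), (∀ w ∈ ws, w.length = b + 3 ∧ w ≠ rev b) →
      Reach b (pre ++ ws.flatten ++ post) (conf b .fwd [] (pre.length + 1) o)
        (conf b .fwd [] (pre.length + ws.flatten.length + 1) (o ++ ws.flatMap emit)) := by
  induction ws with
  | nil => intro pre post o _; simp only [List.flatten_nil, List.flatMap_nil, List.append_nil,
      List.length_nil, add_zero]; exact .refl
  | cons w ws ih =>
    intro pre post o h
    obtain ⟨hw, hr⟩ := h w (by simp)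
    have h1 := reach_block_right (b := b) (m := .fwd) (.inl rfl) pre (ws.flatten ++ post) o w []
      (by rintro rfl; simp at hw) (by simpa using hw)
    have h2 := ih (pre ++ w) post (o ++ emit w) fun w hw => h w (by simp [hw])
    simp only [endBlock, List.nil_append, hr, if_false, List.append_assoc, List.length_append, hw,
      List.length_nil, add_zero, List.flatten_cons, List.flatMap_cons] at h1 h2 ⊢
    rw [← add_assoc pre.length]
    exact h1.trans h2

theorem reach_blocks_skip {b : ℕ} (ws : List (List Bool)) :
    ∀ (pre post o : List Bool), (∀ w ∈ ws, w.length = b + 3 ∧ w ≠ rev b) →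
      Reach b (pre ++ ws.flatten ++ post) (conf b .skip [] (pre.length + 1) o)
        (conf b .skip [] (pre.length + ws.flatten.length + 1) o) := by
  induction ws with
  | nil => intro pre post o _; simp only [List.flatten_nil, List.append_nil,
      List.length_nil, add_zero]; exact .refl
  | cons w ws ih =>
    intro pre post o h
    obtain ⟨hw, hr⟩ := h w (by simp)
    have h1 := reach_block_right (b := b) (m := .skip) (.inr rfl) pre (ws.flatten ++ post) o w []
      (by rintro rfl; simp at hw) (by simpa using hw)
    have h2 := ih (pre ++ w) post o fun w hw => h w (by simp [hw])
    simp only [endBlock, List.nil_append, hr, if_false, List.append_assoc, List.length_append, hw,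
      List.length_nil, add_zero, List.flatten_cons, List.append_nil] at h1 h2 ⊢
    rw [← add_assoc pre.length]
    exact h1.trans h2

theorem reach_blocks_bwd {b : ℕ} (ws : List (List Bool)) :
    ∀ (pre post o : List Bool), (∀ w ∈ ws, w.length = b + 3 ∧ w ≠ beg b) →
      Reach b (pre ++ ws.flatten ++ post) (conf b .bwd [] (pre.length + ws.flatten.length) o)
        (conf b .bwd [] pre.length (o ++ ws.reverse.flatMap emitRev)) := by
  induction ws with
  | nil => intro pre post o _; simp only [List.flatten_nil, List.flatMap_nil, List.append_nil,
      List.length_nil, add_zero, List.reverse_nil]; exact .refl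
  | cons w ws ih =>
    intro pre post o h
    obtain ⟨hw, hr⟩ := h w (by simp)
    have h2 := ih (pre ++ w) post o fun w hw => h w (by simp [hw])
    have h1 := reach_block_left (b := b) pre (ws.flatten ++ post)
      (o ++ ws.reverse.flatMap emitRev) w [] (by rintro rfl; simp at hw) (by simpa using hw)
    simp only [endBlock, hr, if_false, List.append_assoc, List.length_append, hw,
      List.flatten_cons, List.flatMap_cons, List.append_nil,
      List.reverse_cons, List.flatMap_append, List.flatMap_nil] at h1 h2 ⊢
    rw [← add_assoc pre.length]
    exact h2.trans h1

/-- In forward mode, the transducer writes `text` while it passes over `code`. -/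
def Decodes (b : ℕ) (code text : List Bool) : Prop :=
  ∀ pre post o : List Bool, Reach b (pre ++ code ++ post) (conf b .fwd [] (pre.length + 1) o)
    (conf b .fwd [] (pre.length + code.length + 1) (o ++ text))

theorem Decodes.append {b : ℕ} {c₁ c₂ t₁ t₂ : List Bool} (h₁ : Decodes b c₁ t₁)
    (h₂ : Decodes b c₂ t₂) : Decodes b (c₁ ++ c₂) (t₁ ++ t₂) := by
  intro pre post o
  have h3 := h₁ pre (c₂ ++ post) o
  have h4 := h₂ (pre ++ c₁) post (o ++ t₁)
  simp only [List.append_assoc, List.length_append, ← add_assoc] at h3 h4 ⊢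
  exact h3.trans h4

theorem Decodes.outputs {b : ℕ} {code text : List Bool} (h : Decodes b code text) :
    (machine b).Outputs code text := by
  have h1 := h [] [] []
  simp only [List.nil_append, List.append_nil, List.length_nil, zero_add] at h1
  have h0 : Reach b code (conf b .fwd [] 0 []) (conf b .fwd [] 1 []) :=
    reach_right (by simp) rfl (by omega)
  have h2 : Reach b code (conf b .fwd [] (code.length + 1) text)
      (conf b .halt [] code.length (text ++ [])) :=
    reach_left (by simp) (by rw [tapeSymbol_length_add_one]; rfl)
  refine ⟨_, h0.trans (h1.trans h2), PebbleTransducer.mem_final.2 rfl,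
    by simp [conf, PebbleTransducer.cfg]⟩

theorem decodes_blocks {b : ℕ} {ws : List (List Bool)}
    (h : ∀ w ∈ ws, w.length = b + 3 ∧ w ≠ rev b) :
    Decodes b ws.flatten (ws.flatMap emit) :=
  fun pre post o => reach_blocks_fwd ws pre post o h

theorem length_beg (b : ℕ) : (beg b).length = b + 3 := by simp [beg]
theorem length_rev (b : ℕ) : (rev b).length = b + 3 := by simp [rev]
theorem beg_ne_rev (b : ℕ) : beg b ≠ rev b := by simp [beg, rev]

/-- The forward, backward, forward passes over the blocks between `beg` and `rev`. -/
theorem decodes_beg_rev {b : ℕ} {ws : List (List Bool)}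
    (h : ∀ w ∈ ws, w.length = b + 3 ∧ w ≠ rev b ∧ w ≠ beg b) :
    Decodes b (beg b ++ ws.flatten ++ rev b)
      (ws.flatMap emit ++ ws.reverse.flatMap emitRev) := by
  intro pre post o
  -- Each marker acts in one direction only: `beg b` is an ordinary silent block going forward, `rev
  -- b` one going backward.
  have hb : ∀ w ∈ beg b :: ws, w.length = b + 3 ∧ w ≠ rev b := by
    intro w hw
    rcases List.mem_cons.1 hw with rfl | hw
    · exact ⟨length_beg b, beg_ne_rev b⟩
    · exact ⟨(h w hw).1, (h w hw).2.1⟩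
  have hr : ∀ w ∈ ws ++ [rev b], w.length = b + 3 ∧ w ≠ beg b := by
    intro w hw
    rcases List.mem_append.1 hw with hw | hw
    · exact ⟨(h w hw).1, (h w hw).2.2⟩
    · rw [List.mem_singleton.1 hw]
      exact ⟨length_rev b, (beg_ne_rev b).symm⟩
  have e1 : emit (beg b) = [] := rfl
  have e2 : emitRev (rev b) = [] := rfl
  set x := pre ++ (beg b ++ ws.flatten ++ rev b) ++ post with hx
  set t := o ++ ws.flatMap emit
  set t' := t ++ ws.reverse.flatMap emitRev
  set N := pre.length + (b + 3) + ws.flatten.length with hN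
  have s1 : Reach b x (conf b .fwd [] (pre.length + 1) o) (conf b .fwd [] (N + 1) t) := by
    have := reach_blocks_fwd (beg b :: ws) pre (rev b ++ post) o hb
    simpa [e1, length_beg, hx, hN, t, add_assoc] using this
  have s2 : Reach b x (conf b .fwd [] (N + 1) t) (conf b .turnLeft [] (N + (b + 3) + 1) t) := by
    have := reach_block_right (b := b) (m := .fwd) (.inl rfl) (pre ++ beg b ++ ws.flatten) post t
      (rev b) [] (by simp [rev]) (by simp [length_rev])
    simpa [endBlock, length_beg, hx, hN, add_assoc] using this
  have s3 : Reach b x (conf b .turnLeft [] (N + (b + 3) + 1) t)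
      (conf b .bwd [] (N + (b + 3)) t) := by
    have := reach_left (b := b) (x := x) (l := []) (l' := []) (o := t) (o' := []) (m := .turnLeft)
      (m' := .bwd) (i := N + (b + 3)) (by simp) (by simp [δ])
    simpa using this
  have s4 : Reach b x (conf b .bwd [] (N + (b + 3)) t)
      (conf b .bwd [] (pre.length + (b + 3)) t') := by
    have := reach_blocks_bwd (ws ++ [rev b]) (pre ++ beg b) post t hr
    simpa [e2, length_beg, length_rev, hx, hN, t', add_assoc] using this
  have s5 : Reach b x (conf b .bwd [] (pre.length + (b + 3)) t')
      (conf b .turnRight [] pre.length t') := by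
    have := reach_block_left (b := b) pre (ws.flatten ++ rev b ++ post) t' (beg b) []
      (by simp [beg]) (by simp [length_beg])
    simpa [endBlock, length_beg, hx, add_assoc] using this
  have s6 : Reach b x (conf b .turnRight [] pre.length t')
      (conf b .skip [] (pre.length + 1) t') := by
    have := reach_right (b := b) (x := x) (l := []) (l' := []) (o := t') (o' := [])
      (m := .turnRight) (m' := .skip) (i := pre.length) (by simp) (by simp [δ])
      (by simp [hx])
    simpa using this
  have s7 : Reach b x (conf b .skip [] (pre.length + 1) t') (conf b .skip [] (N + 1) t') := by
    have := reach_blocks_skip (beg b :: ws) pre (rev b ++ post) t' hb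
    simpa [length_beg, hx, hN, add_assoc] using this
  have s8 : Reach b x (conf b .skip [] (N + 1) t') (conf b .fwd [] (N + (b + 3) + 1) t') := by
    have := reach_block_right (b := b) (m := .skip) (.inr rfl) (pre ++ beg b ++ ws.flatten) post t'
      (rev b) [] (by simp [rev]) (by simp [length_rev])
    simpa [endBlock, length_beg, hx, hN, add_assoc] using this
  have := s1.trans (s2.trans (s3.trans (s4.trans (s5.trans (s6.trans (s7.trans s8))))))
  have e3 : pre.length + (beg b ++ ws.flatten ++ rev b).length + 1 = N + (b + 3) + 1 := by
    simp [length_beg, length_rev, hN]; ring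
  have e4 : o ++ (ws.flatMap emit ++ ws.reverse.flatMap emitRev) = t' := by simp [t', t]
  rw [e3, e4]
  exact this

/-! ### Codes for arbitrary strings and for mirrored pairs, with their lengths. -/

/-- The code of `u` by single symbols. -/
def lits (b : ℕ) (u : List Bool) : List (List Bool) := u.map (lit b)

theorem length_flatten_of_forall {α : Type} {l : List (List α)} {n : ℕ}
    (h : ∀ w ∈ l, w.length = n) : l.flatten.length = l.length * n := by
  induction l with
  | nil => simp
  | cons w l ih =>
    simp [ih fun w hw => h w (by simp [hw]), h w (by simp), add_mul, add_comm]

theorem mem_lits {b : ℕ} {u w : List Bool} (h : w ∈ lits b u) :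
    w.length = b + 3 ∧ w ≠ rev b ∧ w ≠ beg b := by
  obtain ⟨c, -, rfl⟩ := List.mem_map.1 h
  simp [lit, rev, beg]

theorem mem_raws {b : ℕ} {ds : List (List Bool)} (hds : ∀ d ∈ ds, d.length = b + 2)
    {w : List Bool} (h : w ∈ ds.map raw) :
    w.length = b + 3 ∧ w ≠ rev b ∧ w ≠ beg b := by
  obtain ⟨d, hd, rfl⟩ := List.mem_map.1 h
  simp [raw, rev, beg, hds d hd]

theorem flatMap_emit_lits (b : ℕ) (u : List Bool) : (lits b u).flatMap emit = u := by
  induction u with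
  | nil => rfl
  | cons c u ih => simp [lits, lit, emit] at ih ⊢; exact ih

theorem flatMap_emit_raws (ds : List (List Bool)) : (ds.map raw).flatMap emit = ds.flatten := by
  induction ds with
  | nil => rfl
  | cons d ds ih => simp [raw, emit] at ih ⊢; exact ih

theorem flatMap_emitRev_lits (b : ℕ) (u : List Bool) :
    (lits b u).reverse.flatMap emitRev = [] := by
  refine List.flatMap_eq_nil_iff.2 fun w hw => ?_
  obtain ⟨c, -, rfl⟩ := List.mem_map.1 (List.mem_reverse.1 hw)
  rfl

theorem flatMap_emitRev_raws (ds : List (List Bool)) :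
    (ds.map raw).reverse.flatMap emitRev = ds.flatten.reverse := by
  induction ds with
  | nil => rfl
  | cons d ds ih => simp [raw, emitRev, List.flatMap_append] at ih ⊢; exact ih

theorem exists_chunks {n : ℕ} (hn : 0 < n) (u : List Bool) :
    ∃ (ds : List (List Bool)) (r : List Bool), u = ds.flatten ++ r ∧ (∀ d ∈ ds, d.length = n) ∧
      r.length < n := by
  induction h : u.length using Nat.strong_induction_on generalizing u with
  | _ N ih =>
    by_cases hu : u.length < n
    · exact ⟨[], u, rfl, by simp, hu⟩
    · obtain ⟨ds, r, h1, h2, h3⟩ := ih (u.drop n).length (by simp; omega) (u.drop n) rfl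
      refine ⟨u.take n :: ds, r, ?_, ?_, h3⟩
      · rw [List.flatten_cons, List.append_assoc, ← h1, List.take_append_drop]
      · intro d hd
        rcases List.mem_cons.1 hd with rfl | hd
        · simp; omega
        · exact h2 d hd

theorem exists_decodes_lits (b : ℕ) (u : List Bool) :
    ∃ c, Decodes b c u ∧ c.length = u.length * (b + 3) := by
  have h := decodes_blocks (b := b) (ws := lits b u) fun w hw =>
    ⟨(mem_lits hw).1, (mem_lits hw).2.1⟩
  rw [flatMap_emit_lits] at h
  refine ⟨_, h, ?_⟩
  rw [length_flatten_of_forall fun w hw => (mem_lits hw).1]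
  simp [lits]

/-- Raw blocks give the rate `(b + 3) / (b + 2)`; fewer than `b + 2` remaining symbols are spelt by
`lit` blocks, which gives the additive constant. -/
theorem exists_decodes_raws (b : ℕ) (u : List Bool) :
    ∃ c, Decodes b c u ∧
      (b + 2) * c.length ≤ (b + 3) * u.length + (b + 2) * (b + 3) * (b + 2) := by
  obtain ⟨ds, r, rfl, h2, h3⟩ := exists_chunks (n := b + 2) (by omega) u
  have h := decodes_blocks (b := b) (ws := ds.map raw) fun w hw =>
    ⟨(mem_raws h2 hw).1, (mem_raws h2 hw).2.1⟩
  rw [flatMap_emit_raws] at h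
  obtain ⟨c, hc, hcl⟩ := exists_decodes_lits b r
  refine ⟨_, h.append hc, ?_⟩
  rw [List.length_append, List.length_append, hcl,
    length_flatten_of_forall fun w hw => (mem_raws h2 hw).1, length_flatten_of_forall h2,
    List.length_map]
  have : (b + 2) * (b + 3) * r.length ≤ (b + 2) * (b + 3) * (b + 2) :=
    Nat.mul_le_mul_left _ h3.le
  nlinarith

/-- Raw blocks are written in both directions, so `u` is paid for once. The remainder `r` of `u`,
then `mid`, then `r.reverse` are spelt by `lit` blocks, silent on the way back. In the bound, `2 *
(b + 2)` accounts for the two remainders and `2` for the markers. -/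
theorem exists_decodes_mirror (b : ℕ) (u mid : List Bool) :
    ∃ c, Decodes b c (u ++ mid ++ u.reverse) ∧
      (b + 2) * c.length ≤
        (b + 3) * u.length + (b + 2) * (b + 3) * (mid.length + 2 * (b + 2) + 2) := by
  obtain ⟨ds, r, rfl, h2, h3⟩ := exists_chunks (n := b + 2) (by omega) u
  have hall : ∀ w ∈ ds.map raw ++ lits b (r ++ mid ++ r.reverse),
      w.length = b + 3 ∧ w ≠ rev b ∧ w ≠ beg b := fun w hw =>
    (List.mem_append.1 hw).elim (mem_raws h2) mem_lits
  have h := decodes_beg_rev hall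
  rw [List.flatMap_append, flatMap_emit_raws, flatMap_emit_lits, List.reverse_append,
    List.flatMap_append, flatMap_emitRev_lits, flatMap_emitRev_raws] at h
  refine ⟨beg b ++ (ds.map raw ++ lits b (r ++ mid ++ r.reverse)).flatten ++ rev b, ?_, ?_⟩
  · simpa [List.append_assoc] using h
  · have hl := length_flatten_of_forall fun w hw => (hall w hw).1
    have : (b + 2) * (b + 3) * r.length ≤ (b + 2) * (b + 3) * (b + 2) :=
      Nat.mul_le_mul_left _ h3.le
    rw [List.length_append, List.length_append, hl, length_beg, length_rev]
    simp only [lits, List.length_append, List.length_map, List.length_reverse,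
      length_flatten_of_forall h2]
    nlinarith

end Copier
end PebbleDepth

namespace PebbleDepth

/-! ### Strings without long runs of ones -/

theorem reverse_mem_avoiding {k n : ℕ} {w : List Bool} :
    w.reverse ∈ avoiding k n ↔ w ∈ avoiding k n := by
  have h : List.replicate k true <:+: w.reverse ↔ List.replicate k true <:+: w := by
    rw [← List.reverse_infix, List.reverse_reverse, List.reverse_replicate]
  simp [avoiding, h]

theorem mem_avoiding_of_count {k n : ℕ} {w : List Bool} (h : w.length = n)
    (hc : w.count true < k) : w ∈ avoiding k n := by
  refine ⟨h, fun hi => ?_⟩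
  have := hi.sublist.count_le true
  simp at this
  omega

open Classical in
/-- The finite set `T_n`. -/
noncomputable def avoidingFinset (k n : ℕ) : Finset (List Bool) :=
  (allStrings n).toFinset.filter fun w => w ∈ avoiding k n

theorem mem_avoidingFinset {k n : ℕ} {w : List Bool} :
    w ∈ avoidingFinset k n ↔ w ∈ avoiding k n := by
  simp only [avoidingFinset, Finset.mem_filter, List.mem_toFinset, mem_allStrings,
    and_iff_right_iff_imp]
  exact fun h => h.1

theorem card_avoidingFinset_succ_le (k n : ℕ) :
    (avoidingFinset k (n + 1)).card ≤ 2 * (avoidingFinset k n).card := by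
  have h : avoidingFinset k (n + 1) ⊆
      ((Finset.univ : Finset Bool) ×ˢ avoidingFinset k n).image fun p => p.1 :: p.2 := by
    intro w hw
    obtain ⟨hl, ha⟩ := mem_avoidingFinset.1 hw
    obtain ⟨c, w, rfl⟩ := List.exists_cons_of_length_eq_add_one hl
    refine Finset.mem_image.2 ⟨(c, w), ?_, rfl⟩
    simp only [Finset.mem_product, Finset.mem_univ, true_and]
    exact mem_avoidingFinset.2 ⟨by simpa using hl, fun hi => ha (hi.trans (List.infix_cons List.infix_rfl))⟩
  refine (Finset.card_le_card h).trans (Finset.card_image_le.trans ?_)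
  simp [Finset.card_product]

/-- A run of `j + 1` ones does not fit into `u` and cannot cross the `0`, so it would lie in `w`. -/
theorem append_false_mem_avoiding {j n : ℕ} {u w : List Bool} (hu : u.length = j)
    (hw : w ∈ avoiding (j + 1) n) : u ++ false :: w ∈ avoiding (j + 1) (n + (j + 1)) := by
  refine ⟨by simp [hu, hw.1]; omega, ?_⟩
  rintro ⟨s, t, h⟩
  by_cases hs : s.length ≤ j
  · have h1 := congrArg (fun l => l[j]?) h
    simp [List.getElem?_append, ← hu] at h1
    rw [if_neg (by omega)] at h1
    simp at h1
  · rw [List.append_assoc, List.append_eq_append_iff] at h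
    rcases h with ⟨a, ha, -⟩ | ⟨a, ha, hb⟩
    · have := congrArg List.length ha
      simp at this
      omega
    · cases a with
      | nil =>
        have := congrArg List.length ha
        simp at this
        omega
      | cons c a =>
        simp only [List.cons_append, List.cons.injEq] at hb
        exact hw.2 ⟨a, t, by rw [hb.2, List.append_assoc]⟩

theorem two_pow_mul_card_le (j n : ℕ) :
    2 ^ j * (avoidingFinset (j + 1) n).card ≤ (avoidingFinset (j + 1) (n + (j + 1))).card := by
  have h1 : ((allStrings j).toFinset ×ˢ avoidingFinset (j + 1) n).card =
      2 ^ j * (avoidingFinset (j + 1) n).card := by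
    have hnd : ∀ j, (allStrings j).Nodup := by
      intro j
      induction j with
      | zero => simp [allStrings]
      | succ j ih =>
        rw [allStrings, List.nodup_append]
        refine ⟨ih.map (List.cons_injective), ih.map (List.cons_injective), ?_⟩
        intro a ha b hb
        obtain ⟨a, -, rfl⟩ := List.mem_map.1 ha
        obtain ⟨b, -, rfl⟩ := List.mem_map.1 hb
        simp
    rw [Finset.card_product, List.toFinset_card_of_nodup (hnd j), length_allStrings]
  rw [← h1]
  refine Finset.card_le_card_of_injOn (fun p => p.1 ++ false :: p.2) ?_ ?_
  · rintro ⟨u, w⟩ h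
    simp only [Finset.coe_product, Set.mem_prod, Finset.mem_coe, List.mem_toFinset,
      mem_allStrings, mem_avoidingFinset] at h ⊢
    exact append_false_mem_avoiding h.1 h.2
  · rintro ⟨u, w⟩ h ⟨u', w'⟩ h' he
    simp only [Finset.coe_product, Set.mem_prod, Finset.mem_coe, List.mem_toFinset,
      mem_allStrings] at h h'
    have := List.append_inj he (by rw [h.1, h'.1])
    simp only [List.cons.injEq, true_and] at this
    simp [this]

/-- Of every `j + 1` symbols, `j` can be chosen freely when the last is `0`. -/
theorem two_pow_le_card (j n : ℕ) :
    2 ^ (j * (n / (j + 1))) ≤ (avoidingFinset (j + 1) n).card := by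
  induction n using Nat.strong_induction_on with
  | _ n ih =>
    by_cases hn : n < j + 1
    · rw [Nat.div_eq_of_lt hn]
      simp only [mul_zero, pow_zero]
      exact Finset.card_pos.2 ⟨List.replicate n false,
        mem_avoidingFinset.2 (mem_avoiding_of_count (by simp) (by simp [List.count_replicate]))⟩
    · obtain ⟨m, rfl⟩ := Nat.exists_eq_add_of_le' (not_lt.1 hn)
      refine le_trans ?_ (two_pow_mul_card_le j m)
      rw [Nat.add_div_right m (by omega), Nat.mul_succ, add_comm, pow_add]
      exact Nat.mul_le_mul_left _ (ih m (by omega))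

/-- A palindrome is determined by its first `⌈n/2⌉` symbols. -/
theorem length_le_of_palindromes {k n : ℕ} {l : List (List Bool)} (hl : l.Nodup)
    (h : ∀ w ∈ l, w ∈ palindromes k n) : l.length ≤ 2 ^ ((n + 1) / 2) := by
  rw [← List.toFinset_card_of_nodup hl, ← length_allStrings]
  refine le_trans ?_ (List.toFinset_card_le _)
  refine Finset.card_le_card_of_injOn (fun w => w.take ((n + 1) / 2)) ?_ ?_
  · intro w hw
    have := (h w (by simpa using hw)).1.1
    simp [mem_allStrings]
    omega
  · intro w hw w' hw' he
    have key : ∀ w ∈ l, w = w.take ((n + 1) / 2) ++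
        ((w.take ((n + 1) / 2)).take (n - (n + 1) / 2)).reverse := by
      intro w hw
      obtain ⟨⟨hlen, -⟩, hr⟩ := h w hw
      conv_lhs => rw [← List.take_append_drop ((n + 1) / 2) w]
      congr 1
      rw [List.take_take, min_eq_left (by omega), List.reverse_take, hr, hlen]
      congr 1
      omega
    dsimp only at he
    rw [key w (by simpa using hw), key w' (by simpa using hw'), he]

/-! ### A choice of the listings -/

theorem exists_list_head_last {α : Type} [DecidableEq α] {F : Finset α} {a c : α} (ha : a ∈ F)
    (hc : c ∈ F) (hac : a ≠ c) :
    ∃ l : List α, l.Nodup ∧ (∀ x, x ∈ l ↔ x ∈ F) ∧ l.head? = some a ∧ l.getLast? = some c := by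
  refine ⟨a :: (((F.erase a).erase c).toList ++ [c]), ?_, ?_, rfl, ?_⟩
  · rw [List.nodup_cons, List.nodup_append]
    refine ⟨by simp [hac], Finset.nodup_toList _, by simp, ?_⟩
    intro x hx y hy
    rw [List.mem_singleton] at hy
    rintro rfl
    subst hy
    simp at hx
  · intro x
    simp only [List.mem_cons, List.mem_append, Finset.mem_toList, Finset.mem_erase,
      List.not_mem_nil, or_false]
    by_cases h1 : x = a
    · simp [h1, ha]
    · by_cases h2 : x = c
      · simp [h2, hc]
      · simp [h1, h2]
  · rw [← List.cons_append, List.getLast?_concat]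

open Classical in
/-- One string of each pair `w`, `w⁻¹` in `T_n - A_n`. -/
noncomputable def representatives (k n : ℕ) : Finset (List Bool) :=
  (avoidingFinset k n).filter fun w => Encodable.encode w < Encodable.encode w.reverse

theorem mem_representatives {k n : ℕ} {w : List Bool} : w ∈ representatives k n ↔
    w ∈ avoiding k n ∧ Encodable.encode w < Encodable.encode w.reverse := by
  simp [representatives, mem_avoidingFinset]

theorem reverse_notMem_representatives {k n : ℕ} {w : List Bool} (h : w ∈ representatives k n) :
    w.reverse ∉ representatives k n := by
  intro h'
  have h1 := (mem_representatives.1 h).2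
  have h2 := (mem_representatives.1 h').2
  rw [List.reverse_reverse] at h2
  omega

theorem mem_representatives_or {k n : ℕ} {w : List Bool} :
    (w ∈ representatives k n ∨ w.reverse ∈ representatives k n) ↔
      w ∈ avoiding k n \ palindromes k n := by
  have h1 : Encodable.encode w = Encodable.encode w.reverse ↔ w = w.reverse :=
    Encodable.encode_injective.eq_iff
  have h2 : w ∈ palindromes k n ↔ w ∈ avoiding k n ∧ w = w.reverse := by
    simp [palindromes, eq_comm]
  rw [mem_representatives, mem_representatives, reverse_mem_avoiding, List.reverse_reverse,
    Set.mem_sdiff, h2, ← h1]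
  by_cases h : w ∈ avoiding k n
  · simp only [h, true_and]; omega
  · simp [h]

theorem exists_representative {k n : ℕ} {u : List Bool}
    (hu : u ∈ avoiding k n) (hr : u.reverse ≠ u) (hh : u.head? = some false)
    (hl : u.getLast? = some false) :
    ∃ a ∈ representatives k n, (a = u ∨ a = u.reverse) ∧ a.head? = some false ∧
      a.getLast? = some false := by
  rcases mem_representatives_or.2 ⟨hu, fun h => hr h.2⟩ with h | h
  · exact ⟨u, h, .inl rfl, hh, hl⟩
  · exact ⟨u.reverse, h, .inr rfl, by simp [hl], by simp [hh]⟩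

/-- The end conditions need two different representatives that start and end with `0`. The strings
`010⋯0` and `0110⋯0` or their reverses serve; their numbers of ones tell them apart. -/
theorem exists_listing {k n : ℕ} (hk : 3 ≤ k) (hn : 6 ≤ n) :
    ∃ l : List (List Bool), l.Nodup ∧ (∀ w, w ∈ l ↔ w ∈ representatives k n) ∧
      l.head?.bind List.head? = some false ∧ l.getLast?.bind List.getLast? = some false := by
  obtain ⟨m, rfl⟩ := Nat.exists_eq_add_of_le' hn
  obtain ⟨a, ha, haeq, hah, -⟩ := exists_representative (k := k) (n := m + 6)
    (u := false :: true :: (List.replicate (m + 2) false ++ [false, false]))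
    (mem_avoiding_of_count (by simp) (by simp [List.count_replicate]; omega)) (by simp) (by simp)
    (by rw [← List.cons_append, ← List.cons_append, List.getLast?_append]; simp)
  obtain ⟨c, hc, hceq, -, hcl⟩ := exists_representative (k := k) (n := m + 6)
    (u := false :: true :: true :: (List.replicate (m + 1) false ++ [false, false]))
    (mem_avoiding_of_count (by simp) (by simp [List.count_replicate]; omega)) (by simp) (by simp)
    (by rw [← List.cons_append, ← List.cons_append, ← List.cons_append, List.getLast?_append]
        simp)
  have hac : a ≠ c := by
    have h1 : a.count true = 1 := by
      rcases haeq with rfl | rfl <;> simp [List.count_replicate]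
    have h2 : c.count true = 2 := by
      rcases hceq with rfl | rfl <;> simp [List.count_replicate]
    rintro rfl
    omega
  obtain ⟨l, h1, h2, h3, h4⟩ := exists_list_head_last ha hc hac
  exact ⟨l, h1, h2, by simp [h3, hah], by simp [h4, hcl]⟩

theorem nodup_append_map_reverse {k n : ℕ} {l : List (List Bool)} (hl : l.Nodup)
    (h : ∀ w, w ∈ l ↔ w ∈ representatives k n) : (l ++ l.map List.reverse).Nodup := by
  rw [List.nodup_append]
  refine ⟨hl, hl.map List.reverse_injective, ?_⟩
  intro a ha b hb
  obtain ⟨c, hc, rfl⟩ := List.mem_map.1 hb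
  rintro rfl
  exact reverse_notMem_representatives ((h c).1 hc) ((h _).1 ha)

theorem ncard_avoiding_diff {k n : ℕ} {l : List (List Bool)} (hl : l.Nodup)
    (h : ∀ w, w ∈ l ↔ w ∈ representatives k n) :
    (avoiding k n \ palindromes k n).ncard = 2 * l.length := by
  classical
  have h1 : avoiding k n \ palindromes k n = ((l ++ l.map List.reverse).toFinset : Set _) := by
    ext w
    rw [← mem_representatives_or, ← h, ← h]
    simp only [List.coe_toFinset, Set.mem_ofPred_eq, List.mem_append, List.mem_map]
    refine or_congr_right ⟨fun hw => ⟨_, hw, List.reverse_reverse w⟩, ?_⟩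
    rintro ⟨a, ha, rfl⟩
    rwa [List.reverse_reverse]
  rw [h1, Set.ncard_coe_finset, List.toFinset_card_of_nodup (nodup_append_map_reverse hl h)]
  simp
  ring

/-- For `v = 1` the prescribed size `|T_n - A_n| / 2` is exactly the number of representatives, so
`X_{n,1}` takes them all. -/
theorem exists_blockListing {k : ℕ} (hk : 6 ≤ k) :
    ∃ L : BlockListing k 1, ∀ n, L.X n 2 = [] := by
  classical
  have h : ∀ n, ∃ l : List (List Bool), k ≤ n → l.Nodup ∧ (∀ w, w ∈ l ↔ w ∈ representatives k n) ∧
      l.head?.bind List.head? = some false ∧ l.getLast?.bind List.getLast? = some false := by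
    intro n
    by_cases hn : k ≤ n
    · obtain ⟨l, hl⟩ := exists_listing (k := k) (n := n) (by omega) (by omega)
      exact ⟨l, fun _ => hl⟩
    · exact ⟨[], fun h => absurd h hn⟩
  choose X hX using h
  refine ⟨{
    pal := fun n => ((avoidingFinset k n).filter fun w => w.reverse = w).toList
    X := fun n i => if i = 1 then X n else []
    nodup_pal := fun n _ => Finset.nodup_toList _
    mem_pal := fun n _ w => by simp [palindromes, mem_avoidingFinset]
    nodup_X := fun n hn => by
      simpa [List.range_succ] using nodup_append_map_reverse (hX n hn).1 (hX n hn).2.1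
    mem_X := fun n hn w => by
      rw [← mem_representatives_or, ← (hX n hn).2.1, ← (hX n hn).2.1]
      constructor
      · rintro ⟨i, h1, h2, h3⟩
        by_cases hi : i = 1
        · simpa [hi] using h3
        · simp [hi] at h3
      · exact fun h => ⟨1, le_rfl, by omega, by simpa using h⟩
    length_X := fun n hn i h1 h2 => by
      obtain rfl : i = 1 := by omega
      rw [ncard_avoiding_diff (hX n hn).1 (hX n hn).2.1]
      simp
    ends_X := fun n hn i h1 h2 => by
      by_cases hi : i = 1
      · right
        simpa [hi] using (hX n hn).2.2
      · left
        exact ⟨by omega, by simp [hi]⟩ }, fun n => by simp⟩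

namespace BlockListing

variable {k : ℕ} (L : BlockListing k 1)

/-- The strings of `T_n` in the order in which they occur in the stage `n`. -/
def blocks (n : ℕ) : List (List Bool) := L.pal n ++ (L.X n 1 ++ L.Y n 1)

/-- The stage `n`, cut into the strings of `T_n` and the flags. -/
def pieces (n : ℕ) : List (List Bool) :=
  L.pal n ++ [ones (flagLength k 1 n)] ++ L.X n 1 ++ [ones (flagLength k 1 n + 1)] ++ L.Y n 1 ++
    [ones (flagLength k 1 n + 2)]

end BlockListing
end PebbleDepth

namespace PebbleDepth

/-! ### Prefixes of sequences -/

theorem length_take (S : ℕ → Bool) (n : ℕ) : (take S n).length = n := by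
  simp [take, substring]

theorem getElem?_substring (S : ℕ → Bool) {i len j : ℕ} (h : j < len) :
    (substring S i len)[j]? = some (S (i + j)) := by
  simp [substring, h]

theorem take_prefix_take (S : ℕ → Bool) {a b : ℕ} (h : a ≤ b) : take S a <+: take S b := by
  obtain ⟨c, rfl⟩ := Nat.exists_eq_add_of_le h
  simp [take, substring, List.range_add]

theorem exists_limit {u : ℕ → List Bool} (hu : ∀ m, u m <+: u (m + 1))
    (hlen : ∀ m, m ≤ (u m).length) : ∃ S : ℕ → Bool, ∀ m, take S (u m).length = u m := by
  have hmono : ∀ a b, a ≤ b → u a <+: u b := fun a b h => by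
    induction h with
    | refl => exact List.prefix_rfl
    | step _ ih => exact ih.trans (hu _)
  refine ⟨fun i => (u (i + 1)).getD i false, fun m => ?_⟩
  apply List.ext_getElem (length_take _ _)
  intro i _ h2
  have h3 : i < (u (i + 1)).length := hlen (i + 1)
  simp only [take, substring, List.getElem_map, List.getElem_range, zero_add, List.getD_eq_getElem?_getD,
    List.getElem?_eq_getElem h3, Option.getD_some]
  rcases le_total (i + 1) m with h | h
  · exact (hmono _ _ h).getElem h3
  · exact ((hmono _ _ h).getElem h2).symm

theorem exists_mem_of_lt_length_flatten {α : Type} {l : List (List α)} {p : ℕ}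
    (hp : p < l.flatten.length) :
    ∃ q ∈ l, ∃ a, a ≤ p ∧ p < a + q.length ∧ ∀ j < q.length, l.flatten[a + j]? = q[j]? := by
  induction l generalizing p with
  | nil => simp at hp
  | cons x l ih =>
    by_cases hx : p < x.length
    · refine ⟨x, by simp, 0, by omega, by omega, fun j hj => ?_⟩
      rw [List.flatten_cons, List.getElem?_append_left (by omega), zero_add]
    · simp only [List.flatten_cons, List.length_append] at hp
      obtain ⟨q, hq, a, h1, h2, h3⟩ := ih (p := p - x.length) (by omega)
      refine ⟨q, by simp [hq], x.length + a, by omega, by omega, fun j hj => ?_⟩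
      rw [List.flatten_cons, List.getElem?_append_right (by omega), ← h3 j hj]
      congr 1
      omega

theorem exists_pieces_of_prefix {α : Type} {M : ℕ} {l : List (List α)}
    (hM : ∀ x ∈ l, x.length ≤ M) {p : List α} (hp : p <+: l.flatten) :
    ∃ l' t, l' <+: l ∧ p = l'.flatten ++ t ∧ t.length ≤ M := by
  induction l generalizing p with
  | nil => exact ⟨[], [], List.prefix_rfl, by simpa using hp, by simp⟩
  | cons x l ih =>
    rcases le_total p.length x.length with h | h
    · exact ⟨[], p, List.nil_prefix, rfl, h.trans (hM x (by simp))⟩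
    · obtain ⟨p', rfl⟩ := List.prefix_of_prefix_length_le
        (List.prefix_append x l.flatten) hp h
      obtain ⟨l', t, h1, rfl, h3⟩ := ih (fun x hx => hM x (by simp [hx]))
        (by simpa using hp : p' <+: l.flatten)
      exact ⟨x :: l', t, by simpa using h1, by simp, h3⟩

theorem replicate_infix_of_getElem? {k t : ℕ} {q : List Bool}
    (h : ∀ j < k, q[t + j]? = some true) : List.replicate k true <:+: q := by
  refine ⟨q.take t, (q.drop t).drop k, ?_⟩
  have h1 : List.replicate k true = (q.drop t).take k := by
    apply List.ext_getElem?
    intro j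
    by_cases hj : j < k
    · simp [hj, h j hj]
    · simp [hj]
  rw [h1, List.append_assoc, List.take_append_drop, List.take_append_drop]

/-! ### The stages as lists of pieces, and the rarity of `01^{2k}0`. -/

namespace BlockListing

variable {k : ℕ} {L : BlockListing k 1}

theorem stage_eq_flatten (hL : ∀ n, L.X n 2 = []) (n : ℕ) :
    L.stage n = (L.pieces n).flatten := by
  simp [stage, pieces, zone, Y, hL, List.range_succ, ones]

theorem nodup_blocks {n : ℕ} (hL : ∀ n, L.X n 2 = []) (hn : k ≤ n) : (L.blocks n).Nodup := by
  have h1 : (L.X n 1 ++ L.Y n 1).Nodup := by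
    have := L.nodup_X n hn
    simp only [Nat.reduceAdd, List.range_succ, List.range_zero, List.nil_append,
      List.cons_append, List.flatMap_cons, zero_add, hL, List.flatMap_nil, List.append_nil,
      List.map_nil] at this
    exact ((List.Perm.append_left _ (List.reverse_perm _)).nodup_iff).2 this
  rw [blocks, List.nodup_append]
  refine ⟨L.nodup_pal n hn, h1, ?_⟩
  rintro a ha b hb rfl
  have h2 : a ∈ avoiding k n \ palindromes k n := by
    refine (L.mem_X n hn a).1 ⟨1, le_rfl, by omega, ?_⟩
    simpa [Y] using hb
  exact h2.2 ((L.mem_pal n hn a).1 ha)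

theorem mem_blocks {n : ℕ} (hL : ∀ n, L.X n 2 = []) (hn : k ≤ n) {w : List Bool} :
    w ∈ L.blocks n ↔ w ∈ avoiding k n := by
  have h1 : (w ∈ L.X n 1 ∨ w.reverse ∈ L.X n 1) ↔ w ∈ avoiding k n \ palindromes k n := by
    rw [← L.mem_X n hn]
    constructor
    · exact fun h => ⟨1, le_rfl, by omega, h⟩
    · rintro ⟨i, h1, h2, h3⟩
      obtain rfl | rfl : i = 1 ∨ i = 2 := by omega
      · exact h3
      · simp [hL] at h3
  have h2 : w ∈ L.Y n 1 ↔ w.reverse ∈ L.X n 1 := by simp [Y]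
  rw [blocks, List.mem_append, List.mem_append, h2, h1, L.mem_pal n hn, Set.mem_sdiff]
  have h3 : w ∈ palindromes k n → w ∈ avoiding k n := fun h => h.1
  tauto

theorem length_blocks {n : ℕ} (hL : ∀ n, L.X n 2 = []) (hn : k ≤ n) :
    (L.blocks n).length = (avoidingFinset k n).card := by
  rw [← List.toFinset_card_of_nodup (nodup_blocks hL hn)]
  congr 1
  ext w
  rw [List.mem_toFinset, mem_blocks hL hn, mem_avoidingFinset]

theorem mem_pieces {n : ℕ} (hL : ∀ n, L.X n 2 = []) (hn : k ≤ n) {q : List Bool}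
    (hq : q ∈ L.pieces n) :
    q ∈ avoiding k n ∨ ∃ l, flagLength k 1 n ≤ l ∧ l ≤ flagLength k 1 n + 2 ∧ q = ones l := by
  rw [← mem_blocks hL hn]
  simp only [pieces, blocks, List.mem_append, List.mem_singleton] at hq ⊢
  rcases hq with ((((h | h) | h) | h) | h) | h
  · exact .inl (.inl h)
  · exact .inr ⟨_, le_rfl, by omega, h⟩
  · exact .inl (.inr (.inl h))
  · exact .inr ⟨_, by omega, by omega, h⟩
  · exact .inl (.inr (.inr h))
  · exact .inr ⟨_, by omega, le_rfl, h⟩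

theorem length_stage {n : ℕ} (hL : ∀ n, L.X n 2 = []) (hn : k ≤ n) :
    (L.stage n).length = (avoidingFinset k n).card * n + (3 * flagLength k 1 n + 3) := by
  have h1 := Copier.length_flatten_of_forall (l := L.blocks n) (n := n)
    fun w hw => ((mem_blocks hL hn).1 hw).1
  rw [length_blocks hL hn] at h1
  rw [← h1, stage_eq_flatten hL]
  simp [pieces, blocks, ones]
  omega

theorem upTo_succ (m : ℕ) : L.upTo (m + 1) = L.upTo m ++ L.stage (k + m) := by
  simp [upTo, List.range_succ]

theorem upTo_prefix (m : ℕ) : L.upTo m <+: L.upTo (m + 1) := by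
  rw [upTo_succ]
  exact List.prefix_append _ _

theorem length_upTo_succ (hL : ∀ n, L.X n 2 = []) (m : ℕ) :
    (L.upTo (m + 1)).length = (L.upTo m).length +
      ((avoidingFinset k (k + m)).card * (k + m) + (3 * flagLength k 1 (k + m) + 3)) := by
  rw [upTo_succ, List.length_append, length_stage hL (by omega)]

theorem le_length_upTo (hL : ∀ n, L.X n 2 = []) (m : ℕ) : m ≤ (L.upTo m).length := by
  induction m with
  | zero => omega
  | succ m ih => rw [length_upTo_succ hL]; omega

theorem upTo_mono {a b : ℕ} (h : a ≤ b) : (L.upTo a).length ≤ (L.upTo b).length := by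
  induction h with
  | refl => exact le_rfl
  | step _ ih => exact ih.trans (upTo_prefix _).length_le

theorem exists_between (hL : ∀ n, L.X n 2 = []) {M p : ℕ} (hp : (L.upTo M).length ≤ p) :
    ∃ m, M ≤ m ∧ (L.upTo m).length ≤ p ∧ p < (L.upTo (m + 1)).length := by
  have h : ∃ m, p < (L.upTo (m + 1)).length := ⟨p, le_length_upTo hL (p + 1)⟩
  classical
  refine ⟨Nat.find h, ?_, ?_, Nat.find_spec h⟩
  · by_contra hlt
    have h1 := Nat.find_spec h
    have h2 := upTo_mono (L := L) (a := Nat.find h + 1) (b := M) (by omega)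
    omega
  · rcases Nat.eq_zero_or_pos (Nat.find h) with h0 | h0
    · rw [h0]
      exact (upTo_mono (Nat.zero_le M)).trans hp
    · have h1 := Nat.find_min h (m := Nat.find h - 1) (by omega)
      rw [Nat.sub_add_cancel h0] at h1
      omega

/-- Every position after the first stage lies in a string without `1^k` or in a flag that is longer
than `2k`. -/
theorem exists_piece (hL : ∀ n, L.X n 2 = []) {S : ℕ → Bool} (hS : L.IsSequence S) {p : ℕ}
    (hp : (L.upTo 1).length ≤ p) :
    ∃ (q : List Bool) (a : ℕ), a ≤ p ∧ p < a + q.length ∧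
      (∀ j < q.length, q[j]? = some (S (a + j))) ∧
      ((k ≤ q.length ∧ ¬ List.replicate k true <:+: q) ∨ ∃ l, 2 * k < l ∧ q = ones l) := by
  obtain ⟨m, h1, h2, h3⟩ := exists_between hL hp
  have h4 := hS (m + 1)
  rw [upTo_succ, stage_eq_flatten hL] at h4
  rw [upTo_succ, stage_eq_flatten hL, List.length_append] at h3
  obtain ⟨q, hq, a, ha1, ha2, ha3⟩ := exists_mem_of_lt_length_flatten
    (l := L.pieces (k + m)) (p := p - (L.upTo m).length) (by omega)
  refine ⟨q, (L.upTo m).length + a, by omega, by omega, fun j hj => ?_, ?_⟩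
  · have hlt : a + j < (L.pieces (k + m)).flatten.length := by
      by_contra hge
      have h5 := ha3 j hj
      rw [List.getElem?_eq_none (not_lt.1 hge), List.getElem?_eq_getElem hj] at h5
      simp at h5
    have h5 := congrArg (fun l => l[(L.upTo m).length + (a + j)]?) h4
    rw [take, getElem?_substring _ (by rw [List.length_append]; omega), List.getElem?_append_right (by omega),
      Nat.add_sub_cancel_left, ha3 j hj] at h5
    rw [← h5, zero_add, add_assoc]
  · rcases mem_pieces hL (by omega) hq with h | ⟨l, h, -, rfl⟩
    · exact .inl ⟨by rw [h.1]; omega, h.2⟩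
    -- The strict inequality needs `m ≥ 1`: in stage `k` the first flag has length exactly `2k`.
    · refine .inr ⟨l, ?_, rfl⟩
      simp only [flagLength] at h
      omega

/-- The piece containing the middle of a late occurrence is examined: a string of some `T_n` would
share `k` consecutive ones with the run, and a flag would be too long to fit between the two zeros.
-/
theorem finite_occurrences (hL : ∀ n, L.X n 2 = []) {S : ℕ → Bool} (hS : L.IsSequence S) :
    {i : ℕ | substring S i (2 * k + 2) = [false] ++ ones (2 * k) ++ [false]}.Finite := by
  refine (Set.finite_lt_nat (L.upTo 1).length).subset fun i hi => ?_
  by_contra hlt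
  have hlt : (L.upTo 1).length ≤ i := not_lt.1 hlt
  have hi : substring S i (2 * k + 2) = [false] ++ ones (2 * k) ++ [false] := hi
  have hget : ∀ j < 2 * k + 2,
      some (S (i + j)) = ([false] ++ ones (2 * k) ++ [false])[j]? := fun j hj => by
    rw [← hi, getElem?_substring S hj]
  have h0 : S i = false := by simpa using hget 0 (by omega)
  have h1 : S (i + (2 * k + 1)) = false := by
    have := hget (2 * k + 1) (by omega)
    simpa [ones] using this
  have h2 : ∀ j < 2 * k, S (i + (j + 1)) = true := fun j hj => by
    have := hget (j + 1) (by omega)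
    rw [List.append_assoc, List.singleton_append, List.getElem?_cons_succ,
      List.getElem?_append_left (by simpa [ones] using hj)] at this
    simpa [ones, List.getElem?_replicate, hj] using this
  obtain ⟨q, a, ha1, ha2, hq, hc⟩ := exists_piece hL hS (p := i + k) (by omega)
  rcases hc with ⟨hlen, hno⟩ | ⟨l, hl, rfl⟩
  -- The `k` ones begin where both the piece and the run have begun. They stay inside both because
  -- the piece contains position `i + k` and has length at least `k`.
  · refine hno (replicate_infix_of_getElem? (t := max a (i + 1) - a) fun j hj => ?_)
    rw [hq _ (by omega)]
    have := h2 (max a (i + 1) + j - (i + 1)) (by omega)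
    rw [← this]
    congr 2
    omega
  · simp only [ones, List.length_replicate] at ha2 hq
    have hq' : ∀ j < l, S (a + j) = true := fun j hj => by
      have := hq j hj
      rw [List.getElem?_replicate, if_pos hj] at this
      exact (Option.some.inj this).symm
    have h3 : i < a := by
      by_contra h
      have := hq' (i - a) (by omega)
      rw [show a + (i - a) = i by omega, h0] at this
      simp at this
    have := hq' (i + (2 * k + 1) - a) (by omega)
    rw [show a + (i + (2 * k + 1) - a) = i + (2 * k + 1) by omega, h1] at this
    simp at this

end BlockListing

theorem not_isNormal_of_finite {S : ℕ → Bool} {x : List Bool}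
    (h : {i : ℕ | substring S i x.length = x}.Finite) : ¬ IsNormal S := by
  intro hS
  have h1 := hS x
  have h2 : Filter.Tendsto (fun n : ℕ => (occurrences S x n : ℝ) / n) Filter.atTop (nhds 0) := by
    refine squeeze_zero (fun n => by positivity) (fun n => ?_)
      (tendsto_const_div_atTop_nhds_zero_nat (h.toFinset.card : ℝ))
    gcongr
    refine Finset.card_le_card fun i hi => ?_
    rw [Set.Finite.mem_toFinset]
    exact (Finset.mem_filter.1 hi).2
  have h3 := tendsto_nhds_unique h1 h2
  have : (0 : ℝ) < (1 / 2 : ℝ) ^ x.length := by positivity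
  linarith

end PebbleDepth

namespace PebbleDepth

/-! ### The error terms -/

/-- The error terms are multiples of this number. -/
def err (n : ℕ) : ℕ := n ^ 2 * 2 ^ (19 * n / 20)

/-- The error grows like `m² 2^(0.95m)`, the right side like `2^(0.99m)`. With `β = 2^(1/100)` these
rates are `β^95` and `β^99`. -/
theorem eventually_err_le (K : ℕ) :
    ∀ᶠ m : ℕ in Filter.atTop, K * err (m + 100) ≤ 2 ^ (99 * ((m + 99) / 100)) := by
  obtain ⟨β, hβ1, hβ⟩ : ∃ β : ℝ, 1 < β ∧ β ^ 100 = 2 := by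
    refine ⟨2 ^ (1 / 100 : ℝ), Real.one_lt_rpow (by norm_num) (by norm_num), ?_⟩
    rw [← Real.rpow_natCast, ← Real.rpow_mul (by norm_num)]
    norm_num
  have hβ0 : 0 < β := by linarith
  have h1 : (fun n : ℕ => (n : ℝ) ^ 2 * (β ^ 95) ^ n) =o[Filter.atTop] fun n => (β ^ 99) ^ n := by
    refine isLittleO_pow_const_mul_const_pow_const_pow_of_norm_lt 2 ?_
    rw [Real.norm_of_nonneg (by positivity)]
    exact pow_lt_pow_right₀ hβ1 (by norm_num)
  have hc : 0 < 1 / ((K + 1 : ℝ) * β ^ 9900) := by positivity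
  have h2 := (h1.bound hc)
  have h3 := (Filter.tendsto_add_atTop_nat 100).eventually h2
  filter_upwards [h3] with m hm
  rw [Real.norm_of_nonneg (by positivity), Real.norm_of_nonneg (by positivity), ← pow_mul,
    ← pow_mul, one_div, inv_mul_eq_div, le_div_iff₀ (by positivity)] at hm
  have h4 : (err (m + 100) : ℝ) ≤ ((m + 100 : ℕ) : ℝ) ^ 2 * β ^ (95 * (m + 100)) := by
    rw [err]
    push_cast
    refine mul_le_mul_of_nonneg_left ?_ (by positivity)
    rw [← hβ, ← pow_mul]
    exact pow_le_pow_right₀ hβ1.le (by omega)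
  -- The exponents compare because `100 * ((m + 99) / 100) ≥ m`, the quotient being `⌈m/100⌉`.
  have h5 : β ^ (99 * (m + 100)) ≤ (2 : ℝ) ^ (99 * ((m + 99) / 100)) * β ^ 9900 := by
    rw [← hβ, ← pow_mul, ← pow_add]
    exact pow_le_pow_right₀ hβ1.le (by omega)
  have h6 : (K : ℝ) * err (m + 100) * β ^ 9900 ≤ (2 : ℝ) ^ (99 * ((m + 99) / 100)) * β ^ 9900 := by
    refine le_trans ?_ (hm.trans h5)
    calc (K : ℝ) * err (m + 100) * β ^ 9900
        ≤ (K + 1) * (((m + 100 : ℕ) : ℝ) ^ 2 * β ^ (95 * (m + 100))) * β ^ 9900 := by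
          gcongr
          linarith
      _ = _ := by ring
  have h7 := le_of_mul_le_mul_right h6 (by positivity)
  exact_mod_cast h7

namespace BlockListing

variable {L : BlockListing 100 1}

/-- The last stage in `L.upTo m` has index `m + 99`, and its blocks alone suffice. -/
theorem two_pow_le_length_upTo (hL : ∀ n, L.X n 2 = []) (m : ℕ) (hm : 1 ≤ m) :
    2 ^ (99 * ((m + 99) / 100)) ≤ (L.upTo m).length := by
  obtain ⟨m, rfl⟩ := Nat.exists_eq_add_of_le' hm
  have h1 := length_upTo_succ hL m
  have h2 := two_pow_le_card 99 (100 + m)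
  rw [show m + 1 + 99 = 100 + m by omega]
  nlinarith

/-- A stage is not much longer than twice what comes before it. -/
theorem length_upTo_succ_le (hL : ∀ n, L.X n 2 = []) (m : ℕ) (hm : 1 ≤ m) :
    10 * (L.upTo (m + 1)).length ≤ 32 * (L.upTo m).length + 100 * (m + 100) := by
  obtain ⟨m, rfl⟩ := Nat.exists_eq_add_of_le' hm
  have h1 := length_upTo_succ hL m
  have h2 := length_upTo_succ hL (m + 1)
  have h3 := card_avoidingFinset_succ_le 100 (100 + m)
  simp only [flagLength] at h1 h2
  rw [show 100 + (m + 1) = 100 + m + 1 by omega] at h2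
  set c := (avoidingFinset 100 (100 + m)).card
  set c' := (avoidingFinset 100 (100 + m + 1)).card
  -- The number of blocks at most doubles, and their length grows by a factor of at most `101/100`.
  have h4 : 10 * (c' * (100 + m + 1)) ≤ 22 * (c * (100 + m)) := by nlinarith
  omega

theorem le_err {m : ℕ} : m + 100 ≤ err (m + 100) := by
  rw [err]
  have : 1 ≤ 2 ^ (19 * (m + 100) / 20) := Nat.one_le_two_pow
  nlinarith

/-! ### The lower bound for finite-state transducers -/

theorem sum_deficit_pieces_le (hL : ∀ n, L.X n 2 = []) (T : FST) (M n : ℕ) (hn : 100 ≤ n) :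
    ((L.pieces n).map (T.deficit M)).sum ≤
      (2 ^ (M + 2) * T.numStates + 10) * (n * 2 ^ (19 * n / 20)) := by
  have h1 := T.sum_deficit_le M n (nodup_blocks hL hn)
    fun w hw => ((mem_blocks hL hn).1 hw).1
  have h2 : ∀ l, T.deficit M (ones l) ≤ l := fun l => by
    rw [FST.deficit]
    split_ifs <;> simp [ones]
  have h3 := h2 (flagLength 100 1 n)
  have h4 := h2 (flagLength 100 1 n + 1)
  have h5 := h2 (flagLength 100 1 n + 2)
  have h6 : 3 * flagLength 100 1 n + 3 ≤ 10 * n := by rw [flagLength]; omega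
  have h7 : 10 * n ≤ 10 * (n * 2 ^ (19 * n / 20)) := by
    have : 1 ≤ 2 ^ (19 * n / 20) := Nat.one_le_two_pow
    nlinarith
  have h8 : n * (2 ^ (M + 1) * T.numStates * 2 ^ (19 * n / 20 + 1)) =
      2 ^ (M + 2) * T.numStates * (n * 2 ^ (19 * n / 20)) := by ring
  rw [h8] at h1
  simp only [pieces, blocks, List.map_append, List.sum_append, List.map_cons, List.map_nil,
    List.sum_cons, List.sum_nil] at h1 ⊢
  rw [add_mul]
  omega

theorem mul_two_pow_mono {a b : ℕ} (h : a ≤ b) :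
    a * 2 ^ (19 * a / 20) ≤ b * 2 ^ (19 * b / 20) :=
  Nat.mul_le_mul h (Nat.pow_le_pow_right (by norm_num) (by omega))

theorem upTo_eq_flatten (hL : ∀ n, L.X n 2 = []) (m : ℕ) :
    L.upTo m = (initialPart 100 :: (List.range m).flatMap fun j => L.pieces (100 + j)).flatten := by
  induction m with
  | zero => simp [upTo]
  | succ m ih =>
    rw [upTo_succ, ih, stage_eq_flatten hL, List.range_succ]
    simp only [List.flatten_cons, List.flatMap_append, List.flatMap_cons, List.flatMap_nil,
      List.flatten_append, List.append_assoc, List.append_nil]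

theorem sum_deficit_upTo_le (hL : ∀ n, L.X n 2 = []) (T : FST) (M m : ℕ) :
    ((initialPart 100 :: (List.range m).flatMap fun j => L.pieces (100 + j)).map
      (T.deficit M)).sum ≤ (initialPart 100).length +
        m * ((2 ^ (M + 2) * T.numStates + 10) * ((100 + m) * 2 ^ (19 * (100 + m) / 20))) := by
  induction m with
  | zero =>
    simp only [List.range_zero, List.flatMap_nil, List.map_cons, List.map_nil, List.sum_cons,
      List.sum_nil, FST.deficit]
    split_ifs <;> omega
  | succ m ih =>
    rw [List.range_succ, List.flatMap_append, ← List.cons_append, List.map_append, List.sum_append]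
    have h1 := sum_deficit_pieces_le hL T M (100 + m) (by omega)
    have h2 : (2 ^ (M + 2) * T.numStates + 10) * ((100 + m) * 2 ^ (19 * (100 + m) / 20)) ≤
        (2 ^ (M + 2) * T.numStates + 10) * ((100 + (m + 1)) * 2 ^ (19 * (100 + (m + 1)) / 20)) :=
      Nat.mul_le_mul_left _ (mul_two_pow_mono (by omega))
    simp only [List.flatMap_cons, List.flatMap_nil, List.append_nil]
    have h3 := Nat.mul_le_mul_left m h2
    rw [add_mul, one_mul]
    omega

/-- The prefix is cut into complete pieces and an incomplete one of linear length. The latter and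
the deficits of the complete pieces are absorbed by `err`; the constant `K` depends on `T` only
through its number of states and its maximal output per step. -/
theorem exists_fst_bound (hL : ∀ n, L.X n 2 = []) {S : ℕ → Bool} (hS : L.IsSequence S) (T : FST) :
    ∃ K : ℕ, ∀ m n y, n ≤ (L.upTo (m + 1)).length → T.output y = take S n →
      19 * n ≤ 20 * y.length + K * err (m + 100) := by
  obtain ⟨M, hM⟩ := T.exists_length_out_le
  set A := (initialPart 100).length with hA
  set B := 2 ^ (M + 2) * T.numStates + 10 with hB
  refine ⟨19 * (A + 4) + 19 * (A + 4 * B), fun m n y hn hy => ?_⟩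
  have hpre : take S n <+: L.upTo (m + 1) := by
    rw [← hS (m + 1)]
    exact take_prefix_take S hn
  rw [upTo_eq_flatten hL] at hpre
  obtain ⟨l', t, h1, h2, h3⟩ := exists_pieces_of_prefix (M := A + 4 * (m + 100)) (by
    intro x hx
    rcases List.mem_cons.1 hx with rfl | hx
    · omega
    · obtain ⟨j, hj, hx⟩ := List.mem_flatMap.1 hx
      have hj := List.mem_range.1 hj
      rcases mem_pieces hL (by omega) hx with h | ⟨l, -, h, rfl⟩
      · rw [h.1]; omega
      · simp only [ones, List.length_replicate, flagLength] at h ⊢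
        omega) hpre
  have h4 := FST.length_le_of_output hM (hy.trans h2)
  have h5 := (h1.sublist.map (T.deficit M)).sum_le_sum fun _ _ => Nat.zero_le _
  have h6 := h5.trans (sum_deficit_upTo_le hL T M (m + 1))
  have h7 := congrArg List.length h2
  rw [length_take, List.length_append] at h7
  have h8 := le_err (m := m)
  have h9 : (m + 1) * (B * ((100 + (m + 1)) * 2 ^ (19 * (100 + (m + 1)) / 20))) ≤
      4 * B * err (m + 100) := by
    have e1 : 2 ^ (19 * (100 + (m + 1)) / 20) ≤ 2 * 2 ^ (19 * (m + 100) / 20) := by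
      rw [← pow_succ']
      exact Nat.pow_le_pow_right (by norm_num) (by omega)
    calc (m + 1) * (B * ((100 + (m + 1)) * 2 ^ (19 * (100 + (m + 1)) / 20)))
        ≤ (m + 100) * (B * ((2 * (m + 100)) * (2 * 2 ^ (19 * (m + 100) / 20)))) := by
          gcongr <;> omega
      _ = 4 * B * err (m + 100) := by rw [err]; ring
  have h10 : A ≤ A * err (m + 100) := Nat.le_mul_of_pos_right A (by omega)
  rw [← hA, ← hB] at h6
  have h11 := h6.trans (Nat.add_le_add_left h9 A)
  linarith

/-! ### The upper bound for pebble transducers -/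

/-- The listing of `Y_{n,1}` is arranged so that its concatenation is the reverse of that of
`X_{n,1}`; this part is coded as a mirror. Palindromes and outer flags are few enough to be spelt
symbol by symbol. -/
theorem exists_decodes_stage (hL : ∀ n, L.X n 2 = []) (n : ℕ) (hn : 100 ≤ n) :
    ∃ c, Copier.Decodes 98 c (L.stage n) ∧
      200 * c.length ≤ 101 * (L.stage n).length + 262600 * (n * 2 ^ (19 * n / 20)) := by
  obtain ⟨c₁, h₁, e₁⟩ := Copier.exists_decodes_lits 98
    ((L.pal n).flatten ++ ones (flagLength 100 1 n))
  obtain ⟨c₂, h₂, e₂⟩ := Copier.exists_decodes_mirror 98 (L.X n 1).flatten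
    (ones (flagLength 100 1 n + 1))
  obtain ⟨c₃, h₃, e₃⟩ := Copier.exists_decodes_lits 98 (ones (flagLength 100 1 n + 2))
  have hY : (L.Y n 1).flatten = (L.X n 1).flatten.reverse := by
    rw [Y, List.reverse_flatten]
  have hst : L.stage n = ((L.pal n).flatten ++ ones (flagLength 100 1 n)) ++
      ((L.X n 1).flatten ++ ones (flagLength 100 1 n + 1) ++ (L.X n 1).flatten.reverse) ++
        ones (flagLength 100 1 n + 2) := by
    rw [stage_eq_flatten hL, pieces]
    simp only [List.flatten_append, List.flatten_cons, List.flatten_nil, List.append_nil, hY,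
      List.append_assoc]
  refine ⟨c₁ ++ c₂ ++ c₃, hst ▸ (h₁.append h₂).append h₃, ?_⟩
  have hpal : (L.pal n).flatten.length ≤ n * 2 ^ (19 * n / 20) := by
    rw [Copier.length_flatten_of_forall (n := n) fun w hw => ((L.mem_pal n hn w).1 hw).1.1,
      mul_comm]
    refine Nat.mul_le_mul_left _ ((length_le_of_palindromes (L.nodup_pal n hn)
      fun w hw => (L.mem_pal n hn w).1 hw).trans ?_)
    exact Nat.pow_le_pow_right (by norm_num) (by omega)
  have hE : n ≤ n * 2 ^ (19 * n / 20) := Nat.le_mul_of_pos_right n (by positivity)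
  have hlen := congrArg List.length hst
  simp only [ones, List.length_append, List.length_replicate, List.length_reverse] at e₁ e₂ e₃ hlen ⊢
  -- A `lit` or marker block costs `200 * 101 = 20200` on this scale. There are at most `13` times
  -- `n * 2 ^ (19 * n / 20)` of them: the palindromes account for one, the flags, remainders and
  -- markers for twelve. This gives `262600`.
  have hf : 3 * flagLength 100 1 n + 3 + 202 ≤ 12 * n := by rw [flagLength]; omega
  omega

theorem exists_decodes_upTo (hL : ∀ n, L.X n 2 = []) (m : ℕ) :
    ∃ c, Copier.Decodes 98 c (L.upTo m) ∧
      200 * c.length ≤ 101 * (L.upTo m).length + 20200 * (initialPart 100).length +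
        m * (262600 * ((100 + m) * 2 ^ (19 * (100 + m) / 20))) := by
  induction m with
  | zero =>
    obtain ⟨c, h, e⟩ := Copier.exists_decodes_lits 98 (L.upTo 0)
    refine ⟨c, h, ?_⟩
    have : L.upTo 0 = initialPart 100 := by rw [upTo_eq_flatten hL]; simp
    rw [this] at e ⊢
    omega
  | succ m ih =>
    obtain ⟨c, h, e⟩ := ih
    obtain ⟨c', h', e'⟩ := exists_decodes_stage hL (100 + m) (by omega)
    rw [upTo_succ]
    refine ⟨c ++ c', h.append h', ?_⟩
    have h2 : 262600 * ((100 + m) * 2 ^ (19 * (100 + m) / 20)) ≤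
        262600 * ((100 + (m + 1)) * 2 ^ (19 * (100 + (m + 1)) / 20)) :=
      Nat.mul_le_mul_left _ (mul_two_pow_mono (by omega))
    have h3 := Nat.mul_le_mul_left m h2
    rw [add_mul, one_mul, List.length_append, List.length_append]
    omega

/-- Complete stages cost `101/200` per symbol and the remaining `n - |L.upTo m|` symbols cost
`202/200`. Adding the two gives the combination of lengths in the bound. -/
theorem exists_pb_bound (hL : ∀ n, L.X n 2 = []) {S : ℕ → Bool} (hS : L.IsSequence S) :
    ∃ K : ℕ, ∀ m n, (L.upTo m).length ≤ n →
      ∃ y, (Copier.machine 98).Outputs y (take S n) ∧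
        200 * y.length + 101 * (L.upTo m).length ≤ 202 * n + K * err (m + 100) := by
  refine ⟨20200 * (initialPart 100).length + 262600 + 2020000, fun m n hn => ?_⟩
  obtain ⟨r, hr⟩ : L.upTo m <+: take S n := by
    rw [← hS m]
    exact take_prefix_take S hn
  obtain ⟨c, h, e⟩ := exists_decodes_upTo hL m
  obtain ⟨c', h', e'⟩ := Copier.exists_decodes_raws 98 r
  refine ⟨c ++ c', hr ▸ (h.append h').outputs, ?_⟩
  have h1 := congrArg List.length hr
  rw [List.length_append, length_take] at h1
  rw [List.length_append]
  have h2 := le_err (m := m)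
  have h3 : m * (262600 * ((100 + m) * 2 ^ (19 * (100 + m) / 20))) ≤ 262600 * err (m + 100) := by
    calc m * (262600 * ((100 + m) * 2 ^ (19 * (100 + m) / 20)))
        ≤ (m + 100) * (262600 * ((m + 100) * 2 ^ (19 * (m + 100) / 20))) := by
          rw [add_comm 100 m]
          gcongr
          omega
      _ = 262600 * err (m + 100) := by rw [err]; ring
  have h4 : (initialPart 100).length ≤ (initialPart 100).length * err (m + 100) :=
    Nat.le_mul_of_pos_right _ (by omega)
  rw [add_mul, add_mul, mul_assoc 20200]
  omega

/-- Statements about all late prefixes, from statements about the stage in which they end. -/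
theorem eventually_of_stage (hL : ∀ n, L.X n 2 = []) {P : ℕ → Prop}
    (h : ∀ᶠ m in Filter.atTop, ∀ n, (L.upTo m).length ≤ n → n < (L.upTo (m + 1)).length → P n) :
    ∀ᶠ n in Filter.atTop, P n := by
  obtain ⟨M, hM⟩ := Filter.eventually_atTop.1 h
  filter_upwards [Filter.eventually_ge_atTop (L.upTo M).length] with n hn
  obtain ⟨m, h1, h2, h3⟩ := exists_between hL hn
  exact hM m h1 n h2 h3

theorem eventually_fst (hL : ∀ n, L.X n 2 = []) {S : ℕ → Bool} (hS : L.IsSequence S) (T : FST) :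
    ∀ᶠ n in Filter.atTop, ∀ y, T.output y = take S n → 9 * n ≤ 10 * y.length := by
  obtain ⟨K, hK⟩ := exists_fst_bound hL hS T
  refine eventually_of_stage hL ?_
  filter_upwards [eventually_err_le K, Filter.eventually_ge_atTop 1] with m h1 h2 n h3 h4 y hy
  have h5 := two_pow_le_length_upTo hL m h2
  have h6 := hK m n y h4.le hy
  -- The error is at most `|L.upTo m| ≤ n`, leaving `18 * n ≤ 20 * y.length`.
  omega

theorem eventually_pb (hL : ∀ n, L.X n 2 = []) {S : ℕ → Bool} (hS : L.IsSequence S) :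
    ∀ᶠ n in Filter.atTop, ∃ y, (Copier.machine 98).Outputs y (take S n) ∧
      8 * y.length ≤ 7 * n := by
  obtain ⟨K, hK⟩ := exists_pb_bound hL hS
  refine eventually_of_stage hL ?_
  filter_upwards [eventually_err_le (K + 100), Filter.eventually_ge_atTop 1] with m h1 h2 n h3 h4
  have h5 := two_pow_le_length_upTo hL m h2
  obtain ⟨y, hy, h6⟩ := hK m n h3
  refine ⟨y, hy, ?_⟩
  have h7 := length_upTo_succ_le hL m h2
  have h8 := le_err (m := m)
  rw [add_mul] at h1
  -- Up to errors, `|L.upTo m| ≥ 10n/32`, so `200 * y.length` is at most about `(202 - 100 * 10/32)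
  -- n < 175 n`.
  omega

end BlockListing

/-! ### Depth -/

/-- A description determines its transducer, and there are finitely many strings of length at most
`k`. -/
theorem BinaryRepresentation.finite_size_le {F C : Type} [Primcodable C] {table : F → C}
    (R : BinaryRepresentation table) (k : ℕ) : {T | R.size T ≤ k}.Finite := by
  have h1 : {d : R.D | (d : List Bool) ∈ stringsUpTo k}.Finite :=
    (stringsUpTo k).finite_toSet.preimage Subtype.val_injective.injOn
  refine (h1.image R.σ).subset fun T hT => ?_
  obtain ⟨d, hd⟩ := R.surjective T
  obtain ⟨d', h2, h3⟩ := Nat.sInf_mem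
    (s := {n | ∃ d : R.D, R.σ d = T ∧ (d : List Bool).length = n}) ⟨_, d, hd, rfl⟩
  exact ⟨d', mem_stringsUpTo.2 (h3.le.trans hT), h2⟩

theorem pbDeep_of_eventually {S : ℕ → Bool} (P : PebbleTransducer)
    (hF : ∀ T : FST, ∀ᶠ n in Filter.atTop, ∀ y, T.output y = take S n → 9 * n ≤ 10 * y.length)
    (hP : ∀ᶠ n in Filter.atTop, ∃ y, P.Outputs y (take S n) ∧ 8 * y.length ≤ 7 * n)
    (RFS : BinaryRepresentation FST.table) (RPB : BinaryRepresentation PebbleTransducer.table) :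
    PBDeep RFS RPB S := by
  refine ⟨1 / 40, by norm_num, fun k => ⟨RPB.size P, ?_⟩⟩
  have h1 : ∀ᶠ n in Filter.atTop, ∀ T ∈ {T | RFS.size T ≤ k}, ∀ y, T.output y = take S n →
      9 * n ≤ 10 * y.length :=
    (Filter.eventually_all_finite (RFS.finite_size_le k)).2 fun T _ => hF T
  filter_upwards [h1, hP] with n h2 h3
  obtain ⟨y, hy, hyl⟩ := h3
  -- The quotient is `⌈9n/10⌉`. The bound includes the case of infinite complexity, and the
  -- subtracted pebble complexity is finite by `h5`, so `∞ - ∞` does not occur.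
  have h4 : (((9 * n + 9) / 10 : ℕ) : ℕ∞) ≤ fsComplexity RFS k (take S n) := by
    refine le_sInf ?_
    rintro _ ⟨T, z, hT, hz, rfl⟩
    have := h2 T hT z hz
    exact_mod_cast (show (9 * n + 9) / 10 ≤ z.length by omega)
  have h5 : pbComplexity RPB (RPB.size P) (take S n) ≤ (y.length : ℕ∞) :=
    sInf_le ⟨P, y, le_rfl, hy, rfl⟩
  have hcast : ∀ a : ℕ, (((a : ℕ∞) : ENNReal) : EReal) = ((a : ℝ) : EReal) := fun a => by
    rw [ENat.toENNReal_coe]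
    rfl
  have h6 : ((((9 * n + 9) / 10 : ℕ) : ℝ) : EReal) ≤
      ((fsComplexity RFS k (take S n) : ENNReal) : EReal) := by
    rw [← hcast]
    exact EReal.coe_ennreal_le_coe_ennreal_iff.2 (ENat.toENNReal_le.2 h4)
  have h7 : ((pbComplexity RPB (RPB.size P) (take S n) : ENNReal) : EReal) ≤
      (((y.length : ℕ) : ℝ) : EReal) := by
    rw [← hcast]
    exact EReal.coe_ennreal_le_coe_ennreal_iff.2 (ENat.toENNReal_le.2 h5)
  refine le_trans ?_ (EReal.sub_le_sub h6 h7)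
  rw [← EReal.coe_sub, EReal.coe_le_coe_iff]
  have h8 : ((9 * n : ℕ) : ℝ) ≤ ((10 * ((9 * n + 9) / 10) : ℕ) : ℝ) :=
    Nat.cast_le.2 (by omega)
  have h9 : ((8 * y.length : ℕ) : ℝ) ≤ ((7 * n : ℕ) : ℝ) := Nat.cast_le.2 hyl
  push_cast at h8 h9 ⊢
  linarith

end PebbleDepth

theorem mainTheorem8 :
    ∃ (k v : ℕ) (L : PebbleDepth.BlockListing k v) (S : ℕ → Bool),
      2 < k ∧ 1 ≤ v ∧ L.IsSequence S ∧
      {i : ℕ | PebbleDepth.substring S i (2 * k + 2) =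
        [false] ++ PebbleDepth.ones (2 * k) ++ [false]}.Finite ∧
      ¬ PebbleDepth.IsNormal S ∧
      ∀ (RFS : PebbleDepth.BinaryRepresentation PebbleDepth.FST.table)
        (RPB : PebbleDepth.BinaryRepresentation PebbleDepth.PebbleTransducer.table),
        PebbleDepth.PBDeep RFS RPB S := by
  -- The value `100` makes the growth rate `2^(99/100)` of `T_n` exceed the rate `2^(19/20)` of the
  -- error terms.
  obtain ⟨L, hL⟩ := PebbleDepth.exists_blockListing (k := 100) (by norm_num)
  obtain ⟨S, hS⟩ := PebbleDepth.exists_limit L.upTo_prefix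
    (PebbleDepth.BlockListing.le_length_upTo hL)
  have hfin := PebbleDepth.BlockListing.finite_occurrences hL hS
  refine ⟨100, 1, L, S, by norm_num, le_rfl, hS, hfin, ?_, ?_⟩
  · refine PebbleDepth.not_isNormal_of_finite
      (x := [false] ++ PebbleDepth.ones (2 * 100) ++ [false]) ?_
    rwa [show ([false] ++ PebbleDepth.ones (2 * 100) ++ [false]).length = 2 * 100 + 2 by
      rw [List.length_append, List.length_append, PebbleDepth.ones, List.length_replicate]; rfl]
  · exact PebbleDepth.pbDeep_of_eventually _
      (PebbleDepth.BlockListing.eventually_fst hL hS)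
      (PebbleDepth.BlockListing.eventually_pb hL hS)
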